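/- Let $G$ be a discrete group and let $\mathcal{C}$ be a model category with all small limits and colimits that is left proper (every pushout of a weak equivalence along a cofibration is a weak equivalence) and cofibrantly generated, with a set $I$ of generating cofibrations and a set $J$ of generating trivial cofibrations. Let $G\mathcal{C}$ be the category of functors $BG\to\mathcal{C}$, where $BG$ is the category with one object and endomorphisms $G$. For a subgroup $H\le G$ let $(-)^H\colon G\mathcal{C}\to\mathcal{C}$, $X^H=\lim_{BH}X$, be the fixed point functor. For a $G$-set $S$ and an object $A$ of $\mathcal{C}$ let $S\otimes A$ be the coproduct $\coprod_S A$ with the $G$-action induced by that on $S$. Assume that for every subgroup $H\le G$ the functor $(-)^H$ satisfies the following conditions. 1. It preserves colimits of (small) filtered diagrams in $G\mathcal{C}$ in which each arrow is a cofibration in $\mathcal{C}$ after forgetting the $G$-action. 2. It preserves pushouts of diagrams in which one leg is $G/K\otimes f\colon G/K\otimes A\to G/K\otimes B$ for a subgroup $K\le G$ and a generating cofibration $f\colon A\to B$ in $I$. 3. For every subgroup $K\le G$ and every object $A$ of $\mathcal{C}$, the canonical map $\coprod_{(G/K)^H}A=(G/K)^H\otimes A\to (G/K\otimes A)^H$ is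 an isomorphism in $\mathcal{C}$. Let $\mathscr{O}_G$ be the orbit category of $G$ (objects $G/H$ for all subgroups $H\le G$, morphisms all equivariant maps), and let $\Phi\colon G\mathcal{C}\to\mathrm{Fun}(\mathscr{O}_G^{op},\mathcal{C})$ be the functor with $\Phi(X)(G/H)=X^H$. Then the fixed point model structure on $G\mathcal{C}$ exists, that is, the (necessarily unique) model structure in which a map $f$ is a weak equivalence (respectively a fibration) if and only if $\Phi(f)$ is a levelwise weak equivalence (respectively a levelwise fibration), and it is left proper. -/

import Mathlib

open CategoryTheory Limits HomotopicalAlgebra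

universe v u

namespace GModel

/-- Objects of `C` with an action of the discrete group `G`: functors `BG ⥤ C`, where
`BG = SingleObj G`. -/
abbrev GObj (G : Type v) [Group G] (C : Type u) [Category.{v} C] := SingleObj G ⥤ C

/-- A category with small limits has limits indexed by `BM` for a small monoid `M`. -/
instance hasLimitsOfShape_singleObj (M : Type v) [Monoid M] (C : Type u) [Category.{v} C]
    [HasLimits C] : HasLimitsOfShape (SingleObj M) C :=
  have : HasLimitsOfSize.{v, 0} C := hasLimitsOfSizeOfUnivLE.{v, v} C
  inferInstance

section FixedPoints

variable {G : Type v} [Group G] {C : Type u} [Category.{v} C]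

/-- The underlying (non-equivariant) object of a `G`-object. -/
abbrev under (X : GObj G C) : C := X.obj (SingleObj.star G)

/-- The underlying (non-equivariant) morphism of a morphism of `G`-objects. -/
abbrev underMap {X Y : GObj G C} (f : X ⟶ Y) : under X ⟶ under Y := f.app (SingleObj.star G)

/-- The action of `g : G` on the underlying object of a `G`-object. -/
def act (X : GObj G C) (g : G) : under X ⟶ under X :=
  X.map (X := SingleObj.star G) (Y := SingleObj.star G) g

lemma act_mul (X : GObj G C) (g h : G) : act X (g * h) = act X h ≫ act X g :=
  X.map_comp (X := SingleObj.star G) (Y := SingleObj.star G) (Z := SingleObj.star G) h g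

lemma act_one (X : GObj G C) : act X 1 = 𝟙 _ := X.map_id (SingleObj.star G)

lemma act_naturality {X Y : GObj G C} (f : X ⟶ Y) (g : G) :
    act X g ≫ underMap f = underMap f ≫ act Y g :=
  f.naturality (X := SingleObj.star G) (Y := SingleObj.star G) g

variable [HasLimits C]

/-- The functor `BH ⥤ BG` induced by the inclusion of a subgroup. -/
abbrev inclB (H : Subgroup G) : SingleObj H ⥤ SingleObj G := H.subtype.toFunctor

variable (C) in
/-- The fixed point functor `X ↦ X^H = lim_{BH} X`. -/
noncomputable def fixedPoints (H : Subgroup G) : GObj G C ⥤ C :=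
  (Functor.whiskeringLeft _ _ C).obj (inclB H) ⋙ lim

/-- The projection `X^H ⟶ X` of the limit `X^H` to the underlying object of `X`. -/
noncomputable def fixedι (H : Subgroup G) (X : GObj G C) :
    (fixedPoints C H).obj X ⟶ under X :=
  limit.π (inclB H ⋙ X) (SingleObj.star H)

lemma fixedι_act (H : Subgroup G) (X : GObj G C) {h : G} (hh : h ∈ H) :
    fixedι H X ≫ act X h = fixedι H X :=
  limit.w (inclB H ⋙ X) (j := SingleObj.star H) (j' := SingleObj.star H) (⟨h, hh⟩ : H)

/-- The morphism to `X^H` induced by an `H`-invariant morphism to `X`. -/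
noncomputable def fixedLift (H : Subgroup G) (X : GObj G C) {T : C} (t : T ⟶ under X)
    (ht : ∀ h ∈ H, t ≫ act X h = t) : T ⟶ (fixedPoints C H).obj X :=
  limit.lift (inclB H ⋙ X)
    { pt := T
      π :=
        { app := fun _ => t
          naturality := fun _ _ h =>
            (Category.id_comp _).trans (ht (h : H).1 (h : H).2).symm } }

lemma fixedLift_ι (H : Subgroup G) (X : GObj G C) {T : C} (t : T ⟶ under X)
    (ht : ∀ h ∈ H, t ≫ act X h = t) : fixedLift H X t ht ≫ fixedι H X = t :=
  limit.lift_π _ _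

lemma fixed_hom_ext (H : Subgroup G) (X : GObj G C) {T : C}
    {a b : T ⟶ (fixedPoints C H).obj X} (h : a ≫ fixedι H X = b ≫ fixedι H X) : a = b :=
  limit.hom_ext fun _ => h

lemma fixedPoints_map_ι (H : Subgroup G) {X Y : GObj G C} (f : X ⟶ Y) :
    (fixedPoints C H).map f ≫ fixedι H Y = fixedι H X ≫ underMap f :=
  limMap_π _ _

lemma fixedι_act_congr (K : Subgroup G) (X : GObj G C) {g g' : G}
    (h : (g : G ⧸ K) = (g' : G ⧸ K)) : fixedι K X ≫ act X g = fixedι K X ≫ act X g' := by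
  have hk : g⁻¹ * g' ∈ K := QuotientGroup.eq.1 h
  have : g' = g * (g⁻¹ * g') := by group
  rw [this, act_mul, ← Category.assoc, fixedι_act K X hk]

end FixedPoints

section OrbitCategory

/-- The orbit category of `G`: its objects are the orbits `G/H` for all subgroups `H` of `G`,
its morphisms all `G`-equivariant maps. -/
structure OrbitCategory (G : Type v) [Group G] where
  /-- the subgroup `H` in the orbit `G/H` -/
  stab : Subgroup G

instance (G : Type v) [Group G] : Category.{v} (OrbitCategory G) where
  Hom P Q := (G ⧸ P.stab) →[G] (G ⧸ Q.stab)
  id P := MulActionHom.id G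
  comp φ ψ := MulActionHom.comp ψ φ

variable {G : Type v} [Group G] {C : Type u} [Category.{v} C]

/-- An equivariant map `G/H → G/K`, as a function. -/
abbrev OrbitCategory.toFun {P Q : OrbitCategory G} (φ : P ⟶ Q) : G ⧸ P.stab → G ⧸ Q.stab :=
  MulActionHom.toFun (φ := @id G) (X := G ⧸ P.stab) (Y := G ⧸ Q.stab) φ

/-- A representative `g : G` of the coset `φ(eH) = gK`, for `φ : G/H → G/K` equivariant. -/
noncomputable def OrbitCategory.rep {P Q : OrbitCategory G} (φ : P ⟶ Q) : G :=
  Quotient.out (OrbitCategory.toFun φ ((1 : G) : G ⧸ P.stab))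

lemma OrbitCategory.mk_rep {P Q : OrbitCategory G} (φ : P ⟶ Q) :
    ((OrbitCategory.rep φ : G) : G ⧸ Q.stab) = OrbitCategory.toFun φ ((1 : G) : G ⧸ P.stab) :=
  Quotient.out_eq' _

lemma OrbitCategory.mk_mul_rep {P Q : OrbitCategory G} (φ : P ⟶ Q) (g : G) :
    ((g * OrbitCategory.rep φ : G) : G ⧸ Q.stab) = OrbitCategory.toFun φ (g : G ⧸ P.stab) := by
  have h := MulActionHom.map_smul' (φ := @id G) (X := G ⧸ P.stab) (Y := G ⧸ Q.stab) φ g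
    ((1 : G) : G ⧸ P.stab)
  have h1 : g • ((1 : G) : G ⧸ P.stab) = (g : G ⧸ P.stab) := by
    change ((g * 1 : G) : G ⧸ P.stab) = _
    rw [mul_one]
  rw [h1] at h
  refine Eq.trans ?_ h.symm
  change g • ((OrbitCategory.rep φ : G) : G ⧸ Q.stab) = _
  rw [OrbitCategory.mk_rep]
  rfl

variable [HasLimits C]

/-- The map `X^K ⟶ X^H` induced by an equivariant map `φ : G/H → G/K` with `φ(eH) = gK`; it is
the restriction of the action of `g`. -/
noncomputable def orbitMap (X : GObj G C) {P Q : OrbitCategory G} (φ : P ⟶ Q) :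
    (fixedPoints C Q.stab).obj X ⟶ (fixedPoints C P.stab).obj X :=
  fixedLift P.stab X (fixedι Q.stab X ≫ act X (OrbitCategory.rep φ)) (fun h hh => by
    rw [Category.assoc, ← act_mul]
    apply fixedι_act_congr
    rw [OrbitCategory.mk_mul_rep, OrbitCategory.mk_rep]
    congr 1
    exact QuotientGroup.eq.2 (by simpa using hh))

lemma orbitMap_ι (X : GObj G C) {P Q : OrbitCategory G} (φ : P ⟶ Q) {g : G}
    (hg : (g : G ⧸ Q.stab) = OrbitCategory.toFun φ ((1 : G) : G ⧸ P.stab)) :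
    orbitMap X φ ≫ fixedι P.stab X = fixedι Q.stab X ≫ act X g := by
  rw [orbitMap, fixedLift_ι]
  apply fixedι_act_congr
  rw [OrbitCategory.mk_rep, hg]

variable (G C) in
/-- The functor `Φ` from `G`-objects to functors `O_Gᵒᵖ ⥤ C`, with `Φ(X)(G/H) = X^H`. -/
noncomputable def Phi : GObj G C ⥤ ((OrbitCategory G)ᵒᵖ ⥤ C) where
  obj X :=
    { obj := fun P => (fixedPoints C P.unop.stab).obj X
      map := fun φ => orbitMap X φ.unop
      map_id := fun P => fixed_hom_ext _ _ (by
        rw [orbitMap_ι X (𝟙 P).unop (g := 1) rfl, act_one, Category.comp_id]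
        exact (Category.id_comp _).symm)
      map_comp := fun {P Q R} φ ψ => fixed_hom_ext _ _ (by
        rw [Category.assoc, orbitMap_ι X ψ.unop (OrbitCategory.mk_rep _), ← Category.assoc,
          orbitMap_ι X φ.unop (OrbitCategory.mk_rep _), Category.assoc, ← act_mul]
        apply orbitMap_ι
        rw [OrbitCategory.mk_mul_rep, OrbitCategory.mk_rep]
        rfl) }
  map {X Y} f :=
    { app := fun P => (fixedPoints C P.unop.stab).map f
      naturality := fun P Q φ => fixed_hom_ext _ _ (by
        rw [Category.assoc, Category.assoc, fixedPoints_map_ι, orbitMap_ι Y φ.unop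
          (OrbitCategory.mk_rep _), ← Category.assoc, ← Category.assoc, fixedPoints_map_ι,
          orbitMap_ι X φ.unop (OrbitCategory.mk_rep _), Category.assoc, Category.assoc,
          act_naturality]) }
  map_id X := by ext P; exact (fixedPoints C P.unop.stab).map_id X
  map_comp f g := by ext P; exact (fixedPoints C P.unop.stab).map_comp f g

end OrbitCategory

section Tensor

variable {G : Type v} [Group G] {C : Type u} [Category.{v} C] [HasColimits C]

variable (C) in
/-- The tensor `S ⊗ A` of a `G`-set `S` with an object `A` of `C`: the coproduct `∐_S A`, on
which `g : G` acts by sending the summand indexed by `s` identically to the one indexed by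
`g • s`. -/
noncomputable def tensor (S : Type v) [MulAction G S] : C ⥤ GObj G C where
  obj A :=
    { obj := fun _ => ∐ fun _ : S => A
      map := fun (g : G) => Sigma.desc fun s : S => Sigma.ι (fun _ : S => A) (g • s)
      map_id := fun _ => Sigma.hom_ext _ _ fun s => by
        rw [Sigma.ι_desc, Category.comp_id]
        exact congrArg (Sigma.ι fun _ : S => A) (one_smul G s)
      map_comp := fun (g h : G) => Sigma.hom_ext _ _ fun s => by
        rw [Sigma.ι_desc, ← Category.assoc, Sigma.ι_desc, Sigma.ι_desc]
        exact congrArg (Sigma.ι fun _ : S => A) (mul_smul h g s) }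
  map {A B} f :=
    { app := fun _ => Limits.Sigma.map fun _ : S => f
      naturality := fun _ _ g => Sigma.hom_ext _ _ fun s => by simp }
  map_id A := by ext : 2; exact Sigma.hom_ext _ _ fun s => by simp
  map_comp f g := by ext : 2; exact Sigma.hom_ext _ _ fun s => by simp

/-- The inclusion of the summand of `S ⊗ A` indexed by `s`. -/
noncomputable def tensorι (S : Type v) [MulAction G S] (A : C) (s : S) :
    A ⟶ under ((tensor (G := G) C S).obj A) :=
  Sigma.ι (fun _ : S => A) s

lemma tensorι_act (S : Type v) [MulAction G S] (A : C) (s : S) (g : G) :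
    tensorι S A s ≫ act ((tensor (G := G) C S).obj A) g = tensorι S A (g • s) :=
  Sigma.ι_desc _ _

variable [HasLimits C]

/-- The canonical map `S^H ⊗ A ⟶ (S ⊗ A)^H`, where `S^H ⊗ A` is the coproduct `∐_{S^H} A`:
on the summand indexed by `s` it is induced by the (`H`-invariant) inclusion of that summand. -/
noncomputable def fixedComparison (H : Subgroup G) (S : Type v) [MulAction G S] (A : C) :
    (∐ fun _ : MulAction.fixedPoints H S => A) ⟶
      (fixedPoints C H).obj ((tensor (G := G) C S).obj A) :=
  Sigma.desc fun s => fixedLift H _ (tensorι S A s.1) fun h hh => by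
    rw [tensorι_act]
    exact congrArg (tensorι S A) (s.2 ⟨h, hh⟩)

end Tensor

section ModelStructures

/-- The model category `C` is cofibrantly generated, with `I` a set of generating cofibrations
and `J` a set of generating trivial cofibrations: both are (small) sets that permit the small
object argument, the trivial fibrations are the maps with the right lifting property with respect
to `I`, and the fibrations those with the right lifting property with respect to `J`. -/
structure IsCofibrantlyGeneratedBy {C : Type u} [Category.{v} C] [ModelCategory C]
    (I J : MorphismProperty C) : Prop where
  isSmall_I : MorphismProperty.IsSmall.{v} I
  isSmall_J : MorphismProperty.IsSmall.{v} J
  smallObjectArgument_I : MorphismProperty.HasSmallObjectArgument.{v} I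
  smallObjectArgument_J : MorphismProperty.HasSmallObjectArgument.{v} J
  trivialFibrations_eq : trivialFibrations C = I.rlp
  fibrations_eq : fibrations C = J.rlp

/-- A model category is left proper if every pushout of a weak equivalence along a cofibration
is a weak equivalence. -/
def IsLeftProper (D : Type*) [Category* D] [ModelCategory D] : Prop :=
  ∀ ⦃X Y Z W : D⦄ ⦃h : X ⟶ Y⦄ ⦃f : X ⟶ Z⦄ ⦃f' : Y ⟶ W⦄ ⦃h' : Z ⟶ W⦄,
    IsPushout h f f' h' → Cofibration h → WeakEquivalence f → WeakEquivalence f'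

variable {G : Type v} [Group G] {C : Type u} [Category.{v} C] [ModelCategory C] [HasLimits C]

/-- The three compatibility conditions on the `H`-fixed point functor, relative to a set `I` of
generating cofibrations of `C`. -/
structure FixedPointConditions [HasColimits C] (I : MorphismProperty C) (H : Subgroup G) :
    Prop where
  /-- `(-)^H` preserves filtered colimits of diagrams all of whose arrows are non-equivariant
  cofibrations. -/
  preserves_filtered (D : Type v) [SmallCategory D] [IsFiltered D] (F : D ⥤ GObj G C)
    (hF : ∀ ⦃d d' : D⦄ (a : d ⟶ d'), Cofibration (underMap (F.map a))) :
    PreservesColimit F (fixedPoints C H)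
  /-- `(-)^H` preserves pushouts along `G/K ⊗ f` for `f` a generating cofibration. -/
  preserves_pushouts (K : Subgroup G) ⦃A B : C⦄ (f : A ⟶ B) (hf : I f) ⦃X : GObj G C⦄
    (g : (tensor C (G ⧸ K)).obj A ⟶ X) :
    PreservesColimit (span ((tensor C (G ⧸ K)).map f) g) (fixedPoints C H)
  /-- The canonical map `(G/K)^H ⊗ A ⟶ (G/K ⊗ A)^H` is an isomorphism. -/
  isIso_comparison (K : Subgroup G) (A : C) : IsIso (fixedComparison H (G ⧸ K) A)

/-- `M` is the fixed point model structure on `G`-objects of `C`: a map `f` is a weak equivalence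
or a fibration if and only if `Φ(f)` is one in the projective model structure on `O_Gᵒᵖ ⥤ C`, i.e.
is one levelwise. -/
structure IsFixedPointModelStructure (M : ModelCategory (GObj G C)) : Prop where
  weakEquivalences_eq : weakEquivalences (GObj G C) =
    ((weakEquivalences C).functorCategory (OrbitCategory G)ᵒᵖ).inverseImage (Phi G C)
  fibrations_eq : fibrations (GObj G C) =
    ((fibrations C).functorCategory (OrbitCategory G)ᵒᵖ).inverseImage (Phi G C)

end ModelStructures

end GModel

-- The generators are the maps `G/K ⊗ f` with `f` in `I` or in `J` (`orbitCells`). As `G/K ⊗ -` is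
-- left adjoint to `(-)^K`, the maps with the right lifting property against them are exactly the
-- levelwise trivial fibrations and the levelwise fibrations (`orbitCells_rlp_iff`). By Quillen's
-- recognition principle it remains to see that both sets permit the small object argument and that
-- the saturation of the `J`-cells consists of levelwise weak equivalences.
--
-- The difficulty is that `(-)^H` is a limit and is not assumed to preserve arbitrary colimits. The
-- remedy is to carry three properties of a map `f` through the saturation together: `f` is a
-- non-equivariant cofibration, `(-)^H` preserves every pushout along `f`, and `f^H` is a
-- cofibration, trivial in the case of `J` (`llp_rlp_le_of_le`). Condition 2 starts this for `I`,
-- condition 3 identifies `(G/K ⊗ f)^H` with a coproduct of copies of `f`, and condition 1 handles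
-- transfinite compositions. Condition 1 also handles coproducts, as filtered colimits over finite
-- sets of indices: `(∐ A_i)^H` need not be `∐ A_i^H`, but `(∐ f_i)^H` is a cobase change of `∐
-- f_i^H` (`isPushout_sigmaMap`), which is enough.
--
-- Hence `(-)^H` turns equivariant cell complexes into cell complexes in `C`, and smallness in `C`
-- passes to `G`-objects by adjunction (`hasSmallObjectArgument_of_cells`). Left properness follows
-- by applying `(-)^H` to a pushout along a cofibration and using left properness of `C`.

universe w v₁ v₂ u₁ u₂

namespace GModel

/-! ### Morphisms along which a functor preserves pushouts: closure properties -/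

section PushoutsAlong

variable {D : Type u₁} [Category.{v₁} D] {E : Type u₂} [Category.{v₂} E]

/-- A colimit of pushout squares along morphisms with a fixed source is a pushout square. -/
lemma isPushout_of_isColimit {K : Type*} [Category* K] {F P : K ⥤ D} {A X : D}
    (α : (Functor.const K).obj A ⟶ F) (g : A ⟶ X) (τ : F ⟶ P) (ξ : (Functor.const K).obj X ⟶ P)
    (sq : ∀ k, IsPushout (α.app k) g (τ.app k) (ξ.app k))
    {c : Cocone F} (hc : IsColimit c) {d : Cocone P} (hd : IsColimit d) [Nonempty K]
    {f : A ⟶ c.pt} (hf : ∀ k, α.app k ≫ c.ι.app k = f)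
    {t : c.pt ⟶ d.pt} (ht : ∀ k, c.ι.app k ≫ t = τ.app k ≫ d.ι.app k)
    {x : X ⟶ d.pt} (hx : ∀ k, ξ.app k ≫ d.ι.app k = x) :
    IsPushout f g t x := by
  have k₀ : K := Classical.arbitrary K
  refine ⟨⟨?_⟩, ⟨PushoutCocone.IsColimit.mk _ (fun s => hd.desc ⟨s.pt,
    { app := fun k => (sq k).desc (c.ι.app k ≫ s.inl) s.inr ?_
      naturality := ?_ }⟩) ?_ ?_ ?_⟩⟩
  · rw [← hf k₀, Category.assoc, ht, ← hx k₀, ← Category.assoc, (sq k₀).w, Category.assoc]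
  · rw [← Category.assoc, hf, s.condition]
  · intro k k' a
    apply (sq k).hom_ext
    · simpa [← NatTrans.naturality_assoc] using c.w_assoc a s.inl
    · simp [← NatTrans.naturality_assoc]
  · intro s
    apply hc.hom_ext
    intro k
    simp [reassoc_of% (ht k)]
  · intro s
    simp [← hx k₀]
  · intro s m h1 h2
    apply hd.hom_ext
    intro k
    apply (sq k).hom_ext
    · simp [← h1, reassoc_of% (ht k)]
    · simp [← h2, ← hx k]

/-- The morphisms `f` such that `Φ` preserves all pushouts along `f`. -/
def pushoutsAlong (Φ : D ⥤ E) : MorphismProperty D := fun A _ f =>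
  ∀ ⦃X Y : D⦄ ⦃g : A ⟶ X⦄ ⦃g' : _ ⟶ Y⦄ ⦃f' : X ⟶ Y⦄, IsPushout f g g' f' →
    IsPushout (Φ.map f) (Φ.map g) (Φ.map g') (Φ.map f')

variable {Φ : D ⥤ E}

/-- Pushouts are unique up to isomorphism, so for each `g` it is enough that one chosen pushout
square is preserved. -/
lemma pushoutsAlong_of_exists {A B : D} {f : A ⟶ B}
    (h : ∀ ⦃X : D⦄ (g : A ⟶ X), ∃ (Y : D) (g' : B ⟶ Y) (f' : X ⟶ Y), IsPushout f g g' f' ∧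
      IsPushout (Φ.map f) (Φ.map g) (Φ.map g') (Φ.map f')) : pushoutsAlong Φ f := by
  intro X Y g g' f' sq
  obtain ⟨Y', g'', f'', sq', hsq'⟩ := h g
  refine hsq'.of_iso (Iso.refl _) (Iso.refl _) (Iso.refl _) (Φ.mapIso (sq'.isoIsPushout _ _ sq))
    (by simp) (by simp) ?_ ?_
  · simp [← Functor.map_comp]
  · simp [← Functor.map_comp]

instance : (pushoutsAlong Φ).IsStableUnderCobaseChange where
  of_isPushout {A A' B B' f g f' g'} sq hf X Y k k' f'' sq' := by
    have h1 := hf sq.flip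
    have h2 := hf (sq.flip.paste_vert sq')
    exact IsPushout.of_top (by simpa using h2) (by simp [← Functor.map_comp, sq'.w]) h1

variable [HasPushouts D]

instance : (pushoutsAlong Φ).IsMultiplicative where
  id_mem A X Y g g' f' sq := by
    have := sq.isIso_inr_of_isIso
    exact IsPushout.of_horiz_isIso ⟨by simp only [← Functor.map_comp, sq.w]⟩
  comp_mem f f₂ hf hf₂ := pushoutsAlong_of_exists fun X g => by
    have sq := IsPushout.of_hasPushout f g
    have sq₂ := IsPushout.of_hasPushout f₂ (pushout.inl f g)
    exact ⟨_, _, _, sq.paste_horiz sq₂, by simpa using (hf sq).paste_horiz (hf₂ sq₂)⟩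

instance : (pushoutsAlong Φ).IsStableUnderRetracts where
  of_retract {A B A' B' f f'} r hf' X Y g g' h sq := by
    have hi : r.i.left ≫ f' = f ≫ r.i.right := r.i.w
    have hr : r.r.left ≫ f = f' ≫ r.r.right := r.r.w
    obtain ⟨Y', k, h', sq'⟩ : ∃ (Y' : D) (k : B' ⟶ Y') (h' : X ⟶ Y'),
        IsPushout f' (r.r.left ≫ g) k h' := ⟨_, _, _, IsPushout.of_hasPushout _ _⟩
    let i : Y ⟶ Y' := sq.desc (r.i.right ≫ k) h' (by
        rw [← reassoc_of% hi, sq'.w, Category.assoc, RetractArrow.retract_left_assoc]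
        exact Category.id_comp _)
    let p : Y' ⟶ Y := sq'.desc (r.r.right ≫ g') h (by
        rw [← reassoc_of% hr, sq.w, Category.assoc])
    -- Thus `Y` is a retract of the pushout `Y'` of `f'`; maps out of `Φ Y` are obtained by
    -- restricting maps out of `Φ Y'` along `Φ i`.
    have hip : i ≫ p = 𝟙 Y := sq.hom_ext (by simp [i, p]) (by simp [i, p])
    have hs (s : PushoutCocone (Φ.map f) (Φ.map g)) :
        Φ.map f' ≫ Φ.map r.r.right ≫ s.inl = Φ.map (r.r.left ≫ g) ≫ s.inr := by
      rw [← Φ.map_comp_assoc, ← hr, Φ.map_comp, Category.assoc, s.condition, Φ.map_comp_assoc]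
    refine ⟨⟨by rw [← Φ.map_comp, ← Φ.map_comp, sq.w]⟩,
      ⟨PushoutCocone.IsColimit.mk _ (fun s => Φ.map i ≫ (hf' sq').desc (Φ.map r.r.right ≫ s.inl)
        s.inr (hs s)) ?_ ?_ ?_⟩⟩
    · intro s
      rw [← Φ.map_comp_assoc, sq.inl_desc, Φ.map_comp_assoc, IsPushout.inl_desc,
        ← Φ.map_comp_assoc, RetractArrow.retract_right, Φ.map_id]
      exact Category.id_comp _
    · intro s
      rw [← Φ.map_comp_assoc, sq.inr_desc, IsPushout.inr_desc]
    · intro s m h1 h2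
      -- Uniqueness: `Φ p ≫ m` is forced by the pushout property of `Φ Y'`, and `i ≫ p = 𝟙` recovers
      -- `m`.
      have : Φ.map p ≫ m = (hf' sq').desc (Φ.map r.r.right ≫ s.inl) s.inr (hs s) := by
        apply (hf' sq').hom_ext
        · rw [IsPushout.inl_desc, ← Φ.map_comp_assoc, sq'.inl_desc, Φ.map_comp_assoc, h1]
        · rw [IsPushout.inr_desc, ← Φ.map_comp_assoc, sq'.inr_desc, h2]
      rw [← this, ← Φ.map_comp_assoc, hip, Φ.map_id, Category.id_comp]

end PushoutsAlong

/-! ### Filtered colimits and transfinite compositions -/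

section Saturation

variable {D : Type u₁} [Category.{v₁} D] {E : Type u₂} [Category.{v₂} E] [HasPushouts D]

/-- `Φ` preserves the colimits of those small filtered diagrams all of whose arrows are in `N`. -/
def PreservesFilteredColimitsIn (Φ : D ⥤ E) (N : MorphismProperty D) : Prop :=
  ∀ (K : Type w) [SmallCategory K] [IsFiltered K] (F : K ⥤ D),
    (∀ ⦃k k' : K⦄ (a : k ⟶ k'), N (F.map a)) → PreservesColimit F Φ

variable {Φ : D ⥤ E} {N : MorphismProperty D} (hΦ : PreservesFilteredColimitsIn.{w} Φ N)

include hΦ in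
-- Pushing out the whole diagram under `A` along `g` gives a second filtered diagram `P`, whose
-- arrows are cobase changes of those of `F` and so lie in `N`. Therefore `Φ` preserves both
-- colimits, and the square for `f` and its image are both colimits of pushout squares.
lemma pushoutsAlong_of_isColimit [N.IsStableUnderCobaseChange] [HasColimitsOfSize.{w, w} D]
    {K : Type w} [SmallCategory K] [IsFiltered K]
    {F : K ⥤ D} {A : D} (α : (Functor.const K).obj A ⟶ F) (hα : ∀ k, pushoutsAlong Φ (α.app k))
    (hF : ∀ ⦃k k' : K⦄ (a : k ⟶ k'), N (F.map a)) {c : Cocone F} (hc : IsColimit c)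
    {f : A ⟶ c.pt} (hf : ∀ k, α.app k ≫ c.ι.app k = f) : pushoutsAlong Φ f := by
  apply pushoutsAlong_of_exists
  intro X g
  have : Nonempty K := IsFiltered.nonempty
  let P : K ⥤ D := pushout α ((Functor.const K).map g)
  let τ : F ⟶ P := pushout.inl _ _
  let ξ : (Functor.const K).obj X ⟶ P := pushout.inr _ _
  have sq (k : K) : IsPushout (α.app k) g (τ.app k) (ξ.app k) :=
    (IsPushout.of_hasPushout α ((Functor.const K).map g)).map ((evaluation K D).obj k)
  have hP ⦃k k' : K⦄ (a : k ⟶ k') : N (P.map a) := by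
    refine N.of_isPushout (f := F.map a) (g := τ.app k) (g' := τ.app k') ?_ (hF a)
    -- The naturality square of `τ` is a pushout by cancellation, since `A` and `X` do not vary with
    -- `k`.
    refine IsPushout.of_top ?_ (τ.naturality a).symm (sq k).flip
    have h1 := α.naturality a
    have h2 := ξ.naturality a
    simp only [Functor.const_obj_obj, Functor.const_obj_map, Category.id_comp] at h1 h2
    rw [← h1, ← h2]
    exact (sq k').flip
  have hξ (k k' : K) : ξ.app k ≫ colimit.ι P k = ξ.app k' ≫ colimit.ι P k' := by
    have h (k k' : K) (a : k ⟶ k') : ξ.app k ≫ colimit.ι P k = ξ.app k' ≫ colimit.ι P k' := by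
      have := ξ.naturality a
      simp only [Functor.const_obj_obj, Functor.const_obj_map, Category.id_comp] at this
      rw [this, Category.assoc, colimit.w]
    rw [h k _ (IsFiltered.leftToMax k k'), h k' _ (IsFiltered.rightToMax k k')]
  have k₀ : K := Classical.arbitrary K
  let t : c.pt ⟶ colimit P := hc.desc ⟨_, τ ≫ (colimit.cocone P).ι⟩
  have ht (k) : c.ι.app k ≫ t = τ.app k ≫ colimit.ι P k := by simp [t]
  have := hΦ K F hF
  have := hΦ K P hP
  refine ⟨_, t, _, isPushout_of_isColimit α g τ ξ sq hc (colimit.isColimit P) hf ht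
    (fun k => hξ k k₀), ?_⟩
  refine isPushout_of_isColimit ((Functor.constComp _ _ _).inv ≫ Functor.whiskerRight α Φ)
    (Φ.map g) (Functor.whiskerRight τ Φ)
    ((Functor.constComp _ _ _).inv ≫ Functor.whiskerRight ξ Φ) (fun k => ?_)
    (isColimitOfPreserves Φ hc) (isColimitOfPreserves Φ (colimit.isColimit P)) ?_ ?_ ?_
  · simpa using hα k (sq k)
  · intro k
    simp [← Functor.map_comp, hf]
  · intro k
    simp [← Functor.map_comp, ht]
  · intro k
    simp [← Functor.map_comp, hξ k k₀]

include hΦ in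
lemma pushoutsAlong_map_bot_le [N.IsStableUnderCobaseChange] [HasColimitsOfSize.{w, w} D]
    {J : Type w} [LinearOrder J] [SuccOrder J] [OrderBot J] [WellFoundedLT J] (F : J ⥤ D)
    [F.IsWellOrderContinuous] (hN : ∀ ⦃i j : J⦄ (a : i ⟶ j), N (F.map a))
    (hF : ∀ (j : J) (_ : ¬ IsMax j), pushoutsAlong Φ (F.map (homOfLE (Order.le_succ j))))
    (j : J) : pushoutsAlong Φ (F.map (homOfLE bot_le : ⊥ ⟶ j)) := by
  induction j using SuccOrder.limitRecOn with
  | isMin j hj =>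
    obtain rfl := hj.eq_bot
    simpa using (pushoutsAlong Φ).id_mem _
  | succ j hj hj' =>
    rw [← homOfLE_comp bot_le (Order.le_succ j), F.map_comp]
    exact (pushoutsAlong Φ).comp_mem _ _ hj' (hF j hj)
  | isSuccLimit j hj hj' =>
    -- A limit element lies above `⊥`, so its initial segment is nonempty and hence filtered.
    have : Nonempty (Set.Iio j) := ⟨⟨⊥, Order.IsSuccLimit.bot_lt hj⟩⟩
    refine pushoutsAlong_of_isColimit hΦ (A := F.obj ⊥)
      (F := (Set.principalSegIio j).monotone.functor ⋙ F)
      { app := fun k => F.map (homOfLE bot_le)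
        naturality := fun k k' a => ?_ } (fun k => hj' k.1 k.2) (fun k k' a => hN _)
      (F.isColimitOfIsWellOrderContinuous j hj) (fun k => ?_)
    · exact (Category.id_comp _).trans
        (F.map_comp (homOfLE bot_le : ⊥ ⟶ k.1) (homOfLE (leOfHom a) : k.1 ⟶ k'.1))
    · exact (F.map_comp (homOfLE bot_le : ⊥ ⟶ k.1) (homOfLE k.2.le : k.1 ⟶ j)).symm

section

variable {J : Type w} [LinearOrder J] [SuccOrder J] [OrderBot J] [WellFoundedLT J]
  [N.IsStableUnderCobaseChange] [HasColimitsOfSize.{w, w} D]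
  [MorphismProperty.IsStableUnderTransfiniteComposition.{w} N]

include hΦ

lemma pushoutsAlong_of_transfiniteCompositionOfShape {X Y : D} {f : X ⟶ Y}
    (h : (N ⊓ pushoutsAlong Φ).TransfiniteCompositionOfShape J f) : pushoutsAlong Φ f := by
  have hN ⦃i j : J⦄ (a : i ⟶ j) : N (h.F.map a) := (h.ofLE inf_le_left).mem_map a
  have hbot : pushoutsAlong Φ (h.incl.app ⊥) :=
    pushoutsAlong_of_isColimit hΦ (A := h.F.obj ⊥)
      { app := fun k => h.F.map (homOfLE bot_le)
        naturality := fun k k' a => by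
          dsimp
          rw [Category.id_comp, ← Functor.map_comp]
          rfl }
      (fun j => pushoutsAlong_map_bot_le hΦ h.F hN (fun j hj => (h.map_mem j hj).2) j) hN
      h.isColimit (fun k => by simp)
  rw [← h.fac]
  exact (pushoutsAlong Φ).comp_mem _ _ ((pushoutsAlong Φ).of_isIso _) hbot

/-- The image by `Φ` of a transfinite composition. -/
noncomputable def mapTransfiniteCompositionOfShape {X Y : D} {f : X ⟶ Y}
    (h : N.TransfiniteCompositionOfShape J f) : TransfiniteCompositionOfShape J (Φ.map f) :=
  have hN ⦃i j : J⦄ (a : i ⟶ j) : N (h.F.map a) := h.mem_map a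
  have := hΦ J h.F hN
  { F := h.F ⋙ Φ
    isoBot := Φ.mapIso h.isoBot
    isWellOrderContinuous :=
      ⟨fun j hj => ⟨by
        have : Nonempty (Set.Iio j) := ⟨⟨⊥, Order.IsSuccLimit.bot_lt hj⟩⟩
        have := hΦ _ ((Set.principalSegIio j).monotone.functor ⋙ h.F) (fun k k' a => hN _)
        exact isColimitOfPreserves Φ (h.F.isColimitOfIsWellOrderContinuous j hj)⟩⟩
    incl := Functor.whiskerRight h.incl Φ ≫ (Functor.constComp _ _ _).hom
    isColimit :=
      IsColimit.ofIsoColimit (isColimitOfPreserves Φ h.isColimit)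
        (Cocone.ext (Iso.refl _))
    fac := by simp [← Functor.map_comp] }

end

end Saturation

/-! ### Coproducts of morphisms as filtered colimits over finite sets of indices -/

section Stages

variable {ι : Type w}

lemma le_one_of_fin_two (x : Fin 2) : x ≤ 1 := Fin.le_last x

open Classical in
/-- The characteristic function of membership of `i`, with values in the category `0 ⟶ 1`. -/
noncomputable def memIndex (i : ι) (s : Finset ι) : Fin 2 := if i ∈ s then 1 else 0

lemma memIndex_of_mem {i : ι} {s : Finset ι} (h : i ∈ s) : memIndex i s = 1 := if_pos h

lemma memIndex_of_notMem {i : ι} {s : Finset ι} (h : i ∉ s) : memIndex i s = 0 := if_neg h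

lemma memIndex_mono (i : ι) : Monotone (memIndex i) := by
  intro s t h
  by_cases hi : i ∈ s
  · rw [memIndex_of_mem (h hi)]
    exact Fin.le_last _
  · rw [memIndex_of_notMem hi]
    exact Fin.zero_le _

lemma le_memIndex_of_mem {i : ι} {s : Finset ι} (h : i ∈ s) (x : Fin 2) : x ≤ memIndex i s := by
  rw [memIndex_of_mem h]
  exact Fin.le_last _

variable {E : Type u₂} [Category.{v₂} E]

/-- The morphism `F x ⟶ F y` for `x ≤ y`, where `F : Fin 2 ⥤ E`. -/
abbrev mapLE (F : Fin 2 ⥤ E) {x y : Fin 2} (h : x ≤ y) : F.obj x ⟶ F.obj y := F.map (homOfLE h)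

lemma mapLE_comp (F : Fin 2 ⥤ E) {x y z : Fin 2} (h : x ≤ y) (h' : y ≤ z) :
    mapLE F h ≫ mapLE F h' = mapLE F (h.trans h') := (F.map_comp _ _).symm

lemma mapLE_refl (F : Fin 2 ⥤ E) {x : Fin 2} (h : x ≤ x) : mapLE F h = 𝟙 _ := F.map_id _

lemma mapLE_comp_assoc (F : Fin 2 ⥤ E) {x y z : Fin 2} (h : x ≤ y) (h' : y ≤ z) {Z : E}
    (k : F.obj z ⟶ Z) : mapLE F h ≫ mapLE F h' ≫ k = mapLE F (h.trans h') ≫ k := by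
  rw [← mapLE_comp F h h', Category.assoc]

lemma isIso_mapLE (F : Fin 2 ⥤ E) {x y : Fin 2} (h : x ≤ y) (h' : y ≤ x) : IsIso (mapLE F h) :=
  ⟨mapLE F h', by rw [mapLE_comp, mapLE_refl], by rw [mapLE_comp, mapLE_refl]⟩

lemma mapLE_mem {N : MorphismProperty E} [N.ContainsIdentities] (F : Fin 2 ⥤ E)
    (hF : N (mapLE F (Fin.zero_le 1))) {x y : Fin 2} (h : x ≤ y) : N (mapLE F h) := by
  fin_cases x <;> fin_cases y
  · exact mapLE_refl F h ▸ N.id_mem _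
  · exact hF
  · exact absurd h (by decide)
  · exact mapLE_refl F h ▸ N.id_mem _

variable [HasCoproducts.{w} E]

/-- For a family of morphisms `T i : A i ⟶ B i`, the functor which sends a finite set `s` to the
coproduct of the `B i` for `i ∈ s` and the `A i` for `i ∉ s`. -/
noncomputable def stage (T : ι → Fin 2 ⥤ E) : Finset ι ⥤ E where
  obj s := ∐ fun i => (T i).obj (memIndex i s)
  map f := Limits.Sigma.map fun i => mapLE (T i) (memIndex_mono i (leOfHom f))
  map_id s := Sigma.hom_ext _ _ fun i => by simp [mapLE_refl]
  map_comp f g := Sigma.hom_ext _ _ fun i => by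
    simp [mapLE_comp_assoc]

variable (T : ι → Fin 2 ⥤ E)

/-- The inclusion of a summand of a stage. -/
noncomputable def stageι (s : Finset ι) (i : ι) : (T i).obj (memIndex i s) ⟶ (stage T).obj s :=
  Sigma.ι (fun i => (T i).obj (memIndex i s)) i

variable {T} in
lemma stage_hom_ext {s : Finset ι} {Z : E} {f g : (stage T).obj s ⟶ Z}
    (h : ∀ i, stageι T s i ≫ f = stageι T s i ≫ g) : f = g := Sigma.hom_ext _ _ h

variable {T} in
/-- The morphism from a stage induced by morphisms from its summands. -/
noncomputable def stageDesc {s : Finset ι} {Z : E} (f : ∀ i, (T i).obj (memIndex i s) ⟶ Z) :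
    (stage T).obj s ⟶ Z := Sigma.desc f

variable {T} in
lemma stageι_desc {s : Finset ι} {Z : E} (f : ∀ i, (T i).obj (memIndex i s) ⟶ Z) (i : ι) :
    stageι T s i ≫ stageDesc f = f i := Sigma.ι_desc _ _

lemma stageι_map {s t : Finset ι} (f : s ⟶ t) (i : ι) : stageι T s i ≫ (stage T).map f =
    mapLE (T i) (memIndex_mono i (leOfHom f)) ≫ stageι T t i :=
  Limits.Sigma.ι_map (fun i => mapLE (T i) (memIndex_mono i (leOfHom f))) i

lemma stageι_map_assoc {s t : Finset ι} (f : s ⟶ t) (i : ι) {Z : E} (k : (stage T).obj t ⟶ Z) :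
    stageι T s i ≫ (stage T).map f ≫ k =
      mapLE (T i) (memIndex_mono i (leOfHom f)) ≫ stageι T t i ≫ k := by
  rw [← Category.assoc, stageι_map, Category.assoc]

/-- The map from `∐ A i` to a stage. -/
noncomputable def toStage : (Functor.const (Finset ι)).obj (∐ fun i => (T i).obj 0) ⟶ stage T where
  app s := Limits.Sigma.map fun i => mapLE (T i) (Fin.zero_le _)
  naturality s t f := Sigma.hom_ext _ _ fun i => by
    simp [stage, mapLE_comp_assoc]

lemma ι_toStage (s : Finset ι) (i : ι) : Sigma.ι (fun i => (T i).obj 0) i ≫ (toStage T).app s =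
    mapLE (T i) (Fin.zero_le _) ≫ stageι T s i :=
  Limits.Sigma.ι_map (fun i => mapLE (T i) (Fin.zero_le (memIndex i s))) i

lemma isIso_toStage_empty : IsIso ((toStage T).app ∅) := by
  have (i : ι) : IsIso (mapLE (T i) (Fin.zero_le (memIndex i ∅))) :=
    isIso_mapLE _ _ (by rw [memIndex_of_notMem (Finset.notMem_empty i)])
  exact (Limits.Sigma.mapIso fun i => asIso (mapLE (T i) (Fin.zero_le (memIndex i ∅)))).isIso_hom

/-- The map from a stage to `∐ B i`. -/
noncomputable def fromStage (s : Finset ι) : (stage T).obj s ⟶ ∐ fun i => (T i).obj 1 :=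
  stageDesc fun i => mapLE (T i) (le_one_of_fin_two _) ≫ Sigma.ι (fun i => (T i).obj 1) i

lemma stageι_fromStage (s : Finset ι) (i : ι) : stageι T s i ≫ fromStage T s =
    mapLE (T i) (le_one_of_fin_two _) ≫ Sigma.ι (fun i => (T i).obj 1) i := stageι_desc _ _

lemma stageι_fromStage_assoc (s : Finset ι) (i : ι) {Z : E}
    (k : (∐ fun i => (T i).obj 1) ⟶ Z) : stageι T s i ≫ fromStage T s ≫ k =
      mapLE (T i) (le_one_of_fin_two _) ≫ Sigma.ι (fun i => (T i).obj 1) i ≫ k := by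
  rw [← Category.assoc, stageι_fromStage, Category.assoc]

lemma stage_map_fromStage {s t : Finset ι} (f : s ⟶ t) :
    (stage T).map f ≫ fromStage T t = fromStage T s := stage_hom_ext fun i => by
  rw [stageι_map_assoc, stageι_fromStage, mapLE_comp_assoc, stageι_fromStage]

/-- The cocone on the stages with point `∐ B i`. -/
noncomputable def stageCocone : Cocone (stage T) where
  pt := ∐ fun i => (T i).obj 1
  ι :=
    { app := fun s => fromStage T s
      naturality := fun _ _ f => (stage_map_fromStage T f).trans (Category.comp_id _).symm }

lemma toStage_fromStage (s : Finset ι) : (toStage T).app s ≫ fromStage T s =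
    Limits.Sigma.map fun i => mapLE (T i) (Fin.zero_le 1) :=
  Sigma.hom_ext _ _ fun i => by
    rw [← Category.assoc]
    refine (congrArg (· ≫ fromStage T s) (ι_toStage T s i)).trans ?_
    rw [Category.assoc, stageι_fromStage, mapLE_comp_assoc, Limits.Sigma.ι_map]

/-- At the stage `{i}` the `i`-th summand is already `B i`, so the singletons determine a cocone;
`s` and `{i}` are compared inside `s ∪ {i}`. -/
lemma fromStage_desc {Z : E} (t : ∀ s, (stage T).obj s ⟶ Z)
    (ht : ∀ ⦃s s' : Finset ι⦄ (f : s ⟶ s'), (stage T).map f ≫ t s' = t s) (s : Finset ι) :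
    fromStage T s ≫ Limits.Sigma.desc (fun i =>
      mapLE (T i) (le_memIndex_of_mem (Finset.mem_singleton_self i) _) ≫ stageι T {i} i ≫ t {i}) =
    t s := stage_hom_ext fun i => by
  classical
  rw [stageι_fromStage_assoc, Limits.Sigma.ι_desc,
    ← ht (homOfLE (Finset.subset_union_left : s ⊆ s ∪ {i})),
    ← ht (homOfLE (Finset.subset_union_right : {i} ⊆ s ∪ {i})),
    stageι_map_assoc, stageι_map_assoc, mapLE_comp_assoc, mapLE_comp_assoc]

lemma fromStage_hom_ext {Z : E} {f g : (∐ fun i => (T i).obj 1) ⟶ Z}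
    (h : ∀ s, fromStage T s ≫ f = fromStage T s ≫ g) : f = g := Sigma.hom_ext _ _ fun i => by
  have := congrArg (fun k => mapLE (T i)
    (le_memIndex_of_mem (Finset.mem_singleton_self i) 1) ≫ stageι T {i} i ≫ k) (h {i})
  simpa only [stageι_fromStage_assoc, mapLE_comp_assoc, mapLE_refl, Category.id_comp] using this

/-- The coproduct `∐ B i` is the filtered colimit of the stages. -/
noncomputable def isColimitStageCocone : IsColimit (stageCocone T) where
  desc t := Limits.Sigma.desc fun i =>
    mapLE (T i) (le_memIndex_of_mem (Finset.mem_singleton_self i) _) ≫ stageι T {i} i ≫ t.ι.app {i}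
  fac t s := fromStage_desc T t.ι.app (fun _ _ f => t.w f) s
  uniq t _ hm := fromStage_hom_ext T fun s =>
    (hm s).trans (fromStage_desc T t.ι.app (fun _ _ f => t.w f) s).symm

open Classical in
-- Only the summand at `a` changes from `s` to `insert a s`: a single copy of `A a ⟶ B a` is
-- attached.
lemma isPushout_stage_insert {a : ι} {s : Finset ι} (ha : a ∉ s) :
    IsPushout (mapLE (T a) (Fin.zero_le 1)) (mapLE (T a) (Fin.zero_le _) ≫ stageι T s a)
      (mapLE (T a) (le_memIndex_of_mem (Finset.mem_insert_self a s) _) ≫ stageι T (insert a s) a)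
      ((stage T).map (homOfLE (Finset.subset_insert a s))) := by
  have h0 (i : ι) (hi : i ≠ a) : memIndex i (insert a s) ≤ memIndex i s := by
    by_cases h : i ∈ s
    · exact le_memIndex_of_mem h _
    · rw [memIndex_of_notMem (s := insert a s) (by simp [h, hi])]
      exact Fin.zero_le _
  have h1 : memIndex a s ≤ 0 := by rw [memIndex_of_notMem ha]
  let d (t : PushoutCocone (mapLE (T a) (Fin.zero_le 1))
      (mapLE (T a) (Fin.zero_le _) ≫ stageι T s a)) (i : ι) :
      (T i).obj (memIndex i (insert a s)) ⟶ t.pt :=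
    -- The summand at `a` is mapped by `t.inl`, with a transport since its type depends on `i`;
    -- every other summand is the same in both stages, so `h0` leads back to stage `s`.
    if hi : i = a then mapLE (T i) (le_one_of_fin_two _) ≫ eqToHom (by rw [hi]) ≫ t.inl else
      mapLE (T i) (h0 i hi) ≫ stageι T s i ≫ t.inr
  refine ⟨⟨?_⟩, ⟨PushoutCocone.IsColimit.mk _ (fun t => stageDesc (d t)) ?_ ?_ ?_⟩⟩
  · rw [Category.assoc, stageι_map, mapLE_comp_assoc, mapLE_comp_assoc]
  · intro t
    rw [Category.assoc, stageι_desc]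
    simp only [d, dif_pos, eqToHom_refl, Category.id_comp]
    rw [mapLE_comp_assoc]
    exact (congrArg (· ≫ t.inl) (mapLE_refl (T a) le_rfl)).trans (Category.id_comp _)
  · intro t
    apply stage_hom_ext
    intro i
    rw [stageι_map_assoc, stageι_desc]
    by_cases hi : i = a
    · subst hi
      simp only [d, dif_pos, eqToHom_refl, Category.id_comp]
      have := t.condition
      rw [mapLE_comp_assoc, ← mapLE_comp_assoc (T i) h1 (Fin.zero_le 1)]
      refine (congrArg _ this).trans ?_
      rw [Category.assoc, mapLE_comp_assoc, mapLE_refl, Category.id_comp]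
    · simp only [d, dif_neg hi]
      rw [mapLE_comp_assoc, mapLE_refl, Category.id_comp]
  · intro t m hm1 hm2
    apply stage_hom_ext
    intro i
    rw [stageι_desc]
    by_cases hi : i = a
    · subst hi
      simp only [d, dif_pos, eqToHom_refl, Category.id_comp]
      rw [← hm1, Category.assoc]
      refine Eq.trans ?_ (mapLE_comp_assoc _ _ _ _).symm
      rw [mapLE_refl, Category.id_comp]
    · simp only [d, dif_neg hi]
      rw [← hm2, stageι_map_assoc, mapLE_comp_assoc, mapLE_refl, Category.id_comp]

/-! ### Comparing the stages of the images with the images of the stages -/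

section Comparison

variable {D : Type u₁} [Category.{v₁} D] [HasCoproducts.{w} D] (Φ : D ⥤ E) (T : ι → Fin 2 ⥤ D)

/-- The comparison between the stages in the target and the images of the stages. -/
noncomputable def stageComparison : stage (fun i => T i ⋙ Φ) ⟶ stage T ⋙ Φ where
  app s := stageDesc fun i => Φ.map (stageι T s i)
  naturality s t f := stage_hom_ext fun i => by
    rw [stageι_map_assoc, stageι_desc, ← Category.assoc, stageι_desc]
    simp only [Functor.comp_map, ← Φ.map_comp, stageι_map]

lemma stageι_comparison (s : Finset ι) (i : ι) :
    stageι (fun i => T i ⋙ Φ) s i ≫ (stageComparison Φ T).app s = Φ.map (stageι T s i) :=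
  stageι_desc _ _

/-- The morphism from the coproduct of the images to the image of the coproduct. -/
noncomputable abbrev sigmaComp (A : ι → D) : (∐ fun i => Φ.obj (A i)) ⟶ Φ.obj (∐ A) :=
  Sigma.desc fun i => Φ.map (Sigma.ι A i)

lemma fromStage_comparison (s : Finset ι) :
    fromStage (fun i => T i ⋙ Φ) s ≫ (sigmaComp Φ fun i => (T i).obj 1) =
      (stageComparison Φ T).app s ≫ Φ.map (fromStage T s) := stage_hom_ext fun i => by
  refine (stageι_fromStage_assoc (fun i => T i ⋙ Φ) s i _).trans ?_
  refine (congrArg _ (Limits.Sigma.ι_desc _ _)).trans ?_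
  rw [← Category.assoc, stageι_comparison]
  refine Eq.trans ?_ (Φ.map_comp _ _)
  rw [stageι_fromStage, Φ.map_comp]
  rfl

variable {Φ T}

/-- By induction on `s`: for `∅` both horizontal maps are isomorphisms, and each further index
pastes on one more pushout square. -/
lemma isPushout_stage (hT : ∀ i, pushoutsAlong Φ (mapLE (T i) (Fin.zero_le 1))) (s : Finset ι) :
    IsPushout ((toStage (fun i => T i ⋙ Φ)).app s) (sigmaComp Φ fun i => (T i).obj 0)
      ((stageComparison Φ T).app s) (Φ.map ((toStage T).app s)) := by
  classical
  have hw (s : Finset ι) : (toStage (fun i => T i ⋙ Φ)).app s ≫ (stageComparison Φ T).app s =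
      (sigmaComp Φ fun i => (T i).obj 0) ≫ Φ.map ((toStage T).app s) :=
    Sigma.hom_ext _ _ fun i => by
      rw [← Category.assoc]
      refine (congrArg (· ≫ _) (ι_toStage _ _ _)).trans ?_
      rw [Category.assoc, stageι_comparison, ← Category.assoc, Sigma.ι_desc, ← Φ.map_comp,
        ι_toStage, Φ.map_comp]
      rfl
  induction s using Finset.induction_on with
  | empty =>
    have := isIso_toStage_empty T
    have := isIso_toStage_empty (fun i => T i ⋙ Φ)
    exact IsPushout.of_horiz_isIso ⟨hw ∅⟩
  | insert a s ha ih =>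
    have h1 := isPushout_stage_insert (fun i => T i ⋙ Φ) ha
    have h2 := hT a (isPushout_stage_insert T ha)
    have h3 : IsPushout ((stage (fun i => T i ⋙ Φ)).map (homOfLE (Finset.subset_insert a s)))
        ((stageComparison Φ T).app s) ((stageComparison Φ T).app (insert a s))
        (Φ.map ((stage T).map (homOfLE (Finset.subset_insert a s)))) := by
      -- Cancel the attaching square `h1` in `E` from `h2`, the image under `Φ` of the attaching
      -- square in `D`.
      refine (IsPushout.of_top (h₁₁ := mapLE (T a ⋙ Φ) (Fin.zero_le 1)) ?_ ?_ h1)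
      · rw [Category.assoc, Category.assoc, stageι_comparison, stageι_comparison]
        simp only [Φ.map_comp] at h2
        exact h2
      · exact (stageComparison Φ T).naturality _
    have h4 := ih.paste_horiz h3
    have e1 := (toStage (fun i => T i ⋙ Φ)).naturality (homOfLE (Finset.subset_insert a s))
    have e2 := (toStage T).naturality (homOfLE (Finset.subset_insert a s))
    simp only [Functor.const_obj_obj, Functor.const_obj_map, Category.id_comp] at e1 e2
    rw [e1, e2, Φ.map_comp]
    exact h4

variable {N : MorphismProperty D}

lemma stage_map_mem [N.ContainsIdentities] [MorphismProperty.IsStableUnderCoproducts.{w} N]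
    (hT : ∀ i, N (mapLE (T i) (Fin.zero_le 1))) {s t : Finset ι} (f : s ⟶ t) :
    N ((stage T).map f) :=
  MorphismProperty.colimMap _ fun _ => mapLE_mem _ (hT _) _

variable (hΦ : PreservesFilteredColimitsIn.{w} Φ N)
  [N.ContainsIdentities]
  [MorphismProperty.IsStableUnderCoproducts.{w} N]

include hΦ

lemma isPushout_stage_top (hN : ∀ i, N (mapLE (T i) (Fin.zero_le 1)))
    (hT : ∀ i, pushoutsAlong Φ (mapLE (T i) (Fin.zero_le 1))) :
    IsPushout (Limits.Sigma.map fun i => Φ.map (mapLE (T i) (Fin.zero_le 1)))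
      (sigmaComp Φ fun i => (T i).obj 0) (sigmaComp Φ fun i => (T i).obj 1)
      (Φ.map (Limits.Sigma.map fun i => mapLE (T i) (Fin.zero_le 1))) := by
  classical
  have := hΦ (Finset ι) (stage T) (fun _ _ f => stage_map_mem hN f)
  refine isPushout_of_isColimit (toStage (fun i => T i ⋙ Φ)) (sigmaComp Φ fun i => (T i).obj 0)
    (stageComparison Φ T) ((Functor.constComp _ _ _).inv ≫ Functor.whiskerRight (toStage T) Φ)
    (fun s => by simpa using isPushout_stage hT s) (isColimitStageCocone _)
    (isColimitOfPreserves Φ (isColimitStageCocone T)) (fun s => toStage_fromStage _ s)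
    (t := sigmaComp Φ fun i => (T i).obj 1)
    (x := Φ.map (Limits.Sigma.map fun i => mapLE (T i) (Fin.zero_le 1)))
    (fun s => fromStage_comparison Φ T s) (fun s => ?_)
  rw [← toStage_fromStage T s]
  exact (congrArg (· ≫ Φ.map (fromStage T s)) (Category.id_comp _)).trans (Φ.map_comp _ _).symm

end Comparison

end Stages

/-- Each map from `∐ A i` to a finite stage is a finite composite of cobase changes of the given
maps, and the full coproduct is the filtered colimit of these stages. -/
lemma pushoutsAlong_stage_top {ι : Type w} {D : Type u₁} [Category.{v₁} D] [HasColimitsOfSize.{w, w} D]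
    [HasPushouts D] [HasCoproducts.{w} D]
    {E : Type u₂} [Category.{v₂} E] {Φ : D ⥤ E} {T : ι → Fin 2 ⥤ D} {N : MorphismProperty D}
    (hΦ : PreservesFilteredColimitsIn.{w} Φ N)
    [N.IsStableUnderCobaseChange] [N.IsMultiplicative]
    [MorphismProperty.IsStableUnderCoproducts.{w} N]
    (hN : ∀ i, N (mapLE (T i) (Fin.zero_le 1)))
    (hT : ∀ i, pushoutsAlong Φ (mapLE (T i) (Fin.zero_le 1))) :
    pushoutsAlong Φ (Limits.Sigma.map fun i => mapLE (T i) (Fin.zero_le 1)) := by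
  classical
  refine pushoutsAlong_of_isColimit hΦ (toStage T) (fun s => ?_)
    (fun _ _ f => stage_map_mem hN f) (isColimitStageCocone T) (toStage_fromStage T)
  induction s using Finset.induction_on with
  | empty =>
    have := isIso_toStage_empty T
    exact (pushoutsAlong Φ).of_isIso _
  | insert a s ha ih =>
    have e := (toStage T).naturality (homOfLE (Finset.subset_insert a s))
    simp only [Functor.const_obj_obj, Functor.const_obj_map, Category.id_comp] at e
    rw [e]
    exact (pushoutsAlong Φ).comp_mem _ _ ih
      ((pushoutsAlong Φ).of_isPushout (isPushout_stage_insert T ha).flip (hT a))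

/-! ### The class of coproducts of morphisms in a given class -/

section Coproducts

variable {D : Type u₁} [Category.{v₁} D]

lemma sigmaMap_mem_coproducts [HasCoproducts.{w} D] {S : MorphismProperty D} {ι : Type w}
    {A B : ι → D} (f : ∀ i, A i ⟶ B i) (hf : ∀ i, S (f i)) :
    MorphismProperty.coproducts.{w} S (Limits.Sigma.map f) :=
  MorphismProperty.colimitsOfShape_le_coproducts S ι _
    (MorphismProperty.colimitsOfShape_colimMap _ fun _ => hf _)

instance (S : MorphismProperty D) : (MorphismProperty.coproducts.{w} S).RespectsIso :=
  MorphismProperty.RespectsIso.of_respects_arrow_iso _ fun f g e hf => by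
    rw [MorphismProperty.coproducts_iff] at hf ⊢
    obtain ⟨ι, hι⟩ := hf
    exact ⟨ι, ((S.colimitsOfShape (Discrete ι)).arrow_mk_iso_iff e).1 hι⟩

lemma exists_arrow_iso_sigmaMap [HasCoproducts.{w} D] {S : MorphismProperty D} {X Y : D} (f : X ⟶ Y)
    (hf : MorphismProperty.coproducts.{w} S f) :
    ∃ (ι : Type w) (A B : ι → D) (g : ∀ i, A i ⟶ B i), (∀ i, S (g i)) ∧
      Nonempty (Arrow.mk (Limits.Sigma.map g) ≅ Arrow.mk f) := by
  rw [MorphismProperty.coproducts_iff] at hf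
  obtain ⟨ι, ⟨F₁, F₂, c₁, c₂, h₁, h₂, φ, hφ⟩⟩ := hf
  refine ⟨ι, _, _, fun i => φ.app ⟨i⟩, fun i => hφ ⟨i⟩, ⟨Arrow.isoMk
    (Sigma.isoColimit F₁ ≪≫ IsColimit.coconePointUniqueUpToIso (colimit.isColimit F₁) h₁)
    (Sigma.isoColimit F₂ ≪≫ IsColimit.coconePointUniqueUpToIso (colimit.isColimit F₂) h₂) ?_⟩⟩
  exact Sigma.hom_ext _ _ fun i => by simp

/-- A property of morphisms which holds for the coproducts of morphisms in `S` holds for all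
morphisms that are isomorphic to such coproducts. -/
lemma coproducts_le_of_sigmaMap [HasCoproducts.{w} D] {S P : MorphismProperty D} [P.RespectsIso]
    (h : ∀ {ι : Type w} {A B : ι → D} (f : ∀ i, A i ⟶ B i), (∀ i, S (f i)) →
      P (Limits.Sigma.map f)) : MorphismProperty.coproducts.{w} S ≤ P := by
  intro X Y f hf
  obtain ⟨ι, A, B, g, hg, ⟨e⟩⟩ := exists_arrow_iso_sigmaMap f hf
  exact (P.arrow_mk_iso_iff e).1 (h g hg)

lemma isStableUnderCoproducts_coproducts [HasCoproducts.{w} D] (S : MorphismProperty D) :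
    MorphismProperty.IsStableUnderCoproducts.{w} (MorphismProperty.coproducts.{w} S) where
  isStableUnderCoproductsOfShape ι := by
    apply MorphismProperty.IsStableUnderCoproductsOfShape.mk
    intro X Y _ _ f hf
    choose K A B g hg e using fun i => exists_arrow_iso_sigmaMap (f i) (hf i)
    let p (i : ι) : (∐ A i) ≅ X i := Arrow.leftFunc.mapIso (e i).some
    let q (i : ι) : (∐ B i) ≅ Y i := Arrow.rightFunc.mapIso (e i).some
    have hpq (i : ι) : (p i).hom ≫ f i = Limits.Sigma.map (g i) ≫ (q i).hom := (e i).some.hom.w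
    refine ((MorphismProperty.coproducts.{w} S).arrow_mk_iso_iff (Arrow.isoMk
      ((sigmaSigmaIso K A).symm ≪≫ Sigma.mapIso p)
      ((sigmaSigmaIso K B).symm ≪≫ Sigma.mapIso q) ?_)).1
      (sigmaMap_mem_coproducts (fun x : Σ i, K i => g x.1 x.2) fun x => hg x.1 x.2)
    refine Sigma.hom_ext _ _ fun x => ?_
    simp only [Arrow.mk_left, Arrow.mk_right, Arrow.mk_hom]
    simp [reassoc_of% (hpq x.1)]

end Coproducts

/-! ### The saturation of a class of cells and its image under a functor -/

section Saturation

variable {D : Type u₁} [Category.{v₁} D] {E : Type u₂} [Category.{v₂} E]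
  [HasColimitsOfSize.{w, w} D] [HasPushouts D]
  {Φ : D ⥤ E} {N : MorphismProperty D} (hΦ : PreservesFilteredColimitsIn.{w} Φ N)
  [N.IsStableUnderCobaseChange] [MorphismProperty.IsStableUnderTransfiniteComposition.{w} N]
  [MorphismProperty.IsStableUnderCoproducts.{w} N]

include hΦ

lemma pushoutsAlong_sigmaMap [HasCoproducts.{w} D] {ι : Type w} {A B : ι → D} (f : ∀ i, A i ⟶ B i)
    (hN : ∀ i, N (f i)) (hf : ∀ i, pushoutsAlong Φ (f i)) :
    pushoutsAlong Φ (Limits.Sigma.map f) :=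
  pushoutsAlong_stage_top hΦ (T := fun i => ComposableArrows.mk₁ (f i)) hN hf

omit [HasColimitsOfSize.{w, w} D] [HasPushouts D] [N.IsStableUnderCobaseChange] in
-- This replaces preservation of coproducts by `Φ`, which is not assumed: properties stable under
-- cobase change still pass from the coproduct of the `Φ (f i)` to `Φ` of the coproduct.
lemma isPushout_sigmaMap [HasCoproducts.{w} D] [HasCoproducts.{w} E] {ι : Type w}
    {A B : ι → D} (f : ∀ i, A i ⟶ B i)
    (hN : ∀ i, N (f i)) (hf : ∀ i, pushoutsAlong Φ (f i)) :
    IsPushout (Limits.Sigma.map fun i => Φ.map (f i)) (sigmaComp Φ A) (sigmaComp Φ B)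
      (Φ.map (Limits.Sigma.map f)) :=
  isPushout_stage_top hΦ (T := fun i => ComposableArrows.mk₁ (f i)) hN hf

/-- If `Φ` sends the morphisms in `S` to coproducts of morphisms in `S'`, it sends the pushouts of
coproducts of morphisms in `S` to pushouts of coproducts of morphisms in `S'`. -/
lemma pushouts_coproducts_map [HasCoproducts.{w} D] [HasCoproducts.{w} E]
    {S : MorphismProperty D} {S' : MorphismProperty E}
    (hS : S ≤ N ⊓ pushoutsAlong Φ) (hS' : S ≤ (MorphismProperty.coproducts.{w} S').inverseImage Φ) :
    (MorphismProperty.coproducts.{w} S).pushouts ≤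
      (MorphismProperty.coproducts.{w} S').pushouts.inverseImage Φ := by
  have h : MorphismProperty.coproducts.{w} S ≤
      pushoutsAlong Φ ⊓ (MorphismProperty.coproducts.{w} S').pushouts.inverseImage Φ := by
    apply coproducts_le_of_sigmaMap
    intro ι A B f hf
    refine ⟨pushoutsAlong_sigmaMap hΦ f (fun i => (hS _ (hf i)).1) (fun i => (hS _ (hf i)).2), ?_⟩
    refine MorphismProperty.pushouts_mk _ (isPushout_sigmaMap hΦ f (fun i => (hS _ (hf i)).1)
      (fun i => (hS _ (hf i)).2)).flip ?_
    have := isStableUnderCoproducts_coproducts.{w} S'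
    exact MorphismProperty.colimMap _ fun i => hS' _ (hf i.as)
  rintro X Y f ⟨A, B, m, a, b, hm, sq⟩
  exact MorphismProperty.of_isPushout (P := (MorphismProperty.coproducts.{w} S').pushouts)
    ((h _ hm).1 sq.flip).flip (h _ hm).2

variable [HasCoproducts.{w} D] [HasCoproducts.{w} E]
  {Q : MorphismProperty E} [Q.IsStableUnderCobaseChange]
  [MorphismProperty.IsStableUnderTransfiniteComposition.{w} Q]
  [MorphismProperty.IsStableUnderCoproducts.{w} Q] [Q.IsStableUnderRetracts]

omit [HasColimitsOfSize.{w, w} D] [HasPushouts D] [N.IsStableUnderCobaseChange]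
  [MorphismProperty.IsStableUnderCoproducts.{w} N] [HasCoproducts.{w} D] [HasCoproducts.{w} E]
  [Q.IsStableUnderCobaseChange] [MorphismProperty.IsStableUnderCoproducts.{w} Q]
  [Q.IsStableUnderRetracts] in
lemma map_mem_of_transfiniteCompositionOfShape {J : Type w} [LinearOrder J] [SuccOrder J]
    [OrderBot J] [WellFoundedLT J] {X Y : D} {f : X ⟶ Y}
    (h : (N ⊓ Q.inverseImage Φ).TransfiniteCompositionOfShape J f) : Q (Φ.map f) := by
  have h' : Q.TransfiniteCompositionOfShape J (Φ.map f) :=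
    { toTransfiniteCompositionOfShape := mapTransfiniteCompositionOfShape hΦ (h.ofLE inf_le_left)
      map_mem := fun j hj => (h.map_mem j hj).2 }
  exact MorphismProperty.transfiniteCompositionsOfShape_le Q _ _ h'.mem

/-- The class of morphisms `f` in `N` such that `Φ` preserves pushouts along `f` and sends `f` to
`Q` is saturated. -/
lemma llp_rlp_le_of_le [N.IsStableUnderRetracts] {S : MorphismProperty D} [MorphismProperty.HasSmallObjectArgument.{w} S]
    (hS : S ≤ N ⊓ pushoutsAlong Φ) (hQ : S ≤ Q.inverseImage Φ) :
    S.rlp.llp ≤ N ⊓ pushoutsAlong Φ ⊓ Q.inverseImage Φ := by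
  have h1 : MorphismProperty.coproducts.{w} S ≤ N ⊓ pushoutsAlong Φ ⊓ Q.inverseImage Φ := by
    apply coproducts_le_of_sigmaMap
    intro ι A B f hf
    have h1 := fun i => (hS _ (hf i)).1
    have h2 := fun i => (hS _ (hf i)).2
    refine ⟨⟨MorphismProperty.colimMap _ fun i => h1 i.as, pushoutsAlong_sigmaMap hΦ f h1 h2⟩, ?_⟩
    refine MorphismProperty.of_isPushout (P := Q) (isPushout_sigmaMap hΦ f h1 h2).flip ?_
    exact MorphismProperty.colimMap _ fun i => hQ _ (hf i.as)
  have h2 : (MorphismProperty.coproducts.{w} S).pushouts ≤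
      N ⊓ pushoutsAlong Φ ⊓ Q.inverseImage Φ := by
    rintro X Y f ⟨A, B, m, a, b, hm, sq⟩
    obtain ⟨⟨hN, hP⟩, hQ'⟩ := h1 _ hm
    exact ⟨⟨MorphismProperty.of_isPushout sq hN, MorphismProperty.of_isPushout sq hP⟩,
      MorphismProperty.of_isPushout (P := Q) (hP sq.flip).flip hQ'⟩
  -- By the small object argument, the saturation consists of retracts of transfinite compositions
  -- of pushouts of coproducts of maps in `S`.
  rw [MorphismProperty.llp_rlp_of_hasSmallObjectArgument'.{w}]
  rintro X Y f ⟨X', Y', f', r, ⟨h⟩⟩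
  have hN := (h.ofLE h2).ofLE (inf_le_left.trans inf_le_left)
  refine ⟨⟨MorphismProperty.of_retract r
      (MorphismProperty.transfiniteCompositionsOfShape_le _ _ _ hN.mem),
    MorphismProperty.of_retract r
      (pushoutsAlong_of_transfiniteCompositionOfShape hΦ ((h.ofLE h2).ofLE inf_le_left))⟩,
    MorphismProperty.of_retract (P := Q) (r.map Φ) ?_⟩
  exact map_mem_of_transfiniteCompositionOfShape hΦ
    ((h.ofLE h2).ofLE (inf_le_inf_right _ inf_le_left))

end Saturation

/-! ### Transferring the small object argument -/

section SmallObjectArgument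

variable {D : Type u₁} [Category.{w} D] {E : Type u₂} [Category.{w} E]
  [HasColimitsOfSize.{w, w} D] [HasColimitsOfSize.{w, w} E] {N : MorphismProperty D}
  [N.IsStableUnderCobaseChange] [MorphismProperty.IsStableUnderTransfiniteComposition.{w} N]
  [MorphismProperty.IsStableUnderCoproducts.{w} N]

/-- `S` permits the small object argument if the functors corepresented by the sources of its
elements factor through functors `Φ` under which the cell complexes for `S` become cell complexes
for a class `S'` which permits the small object argument. -/
lemma hasSmallObjectArgument_of_cells {S : MorphismProperty D} {S' : MorphismProperty E}
    [MorphismProperty.IsSmall.{w} S] [MorphismProperty.HasSmallObjectArgument.{w} S']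
    (h : ∀ ⦃A B : D⦄ (f : A ⟶ B), S f → ∃ (Φ : D ⥤ E) (A' B' : E) (f' : A' ⟶ B'), S' f' ∧
      Nonempty (Φ ⋙ coyoneda.obj (Opposite.op A') ≅ coyoneda.obj (Opposite.op A)) ∧
      PreservesFilteredColimitsIn.{w} Φ N ∧ S ≤ N ⊓ pushoutsAlong Φ ∧
      S ≤ (MorphismProperty.coproducts.{w} S').inverseImage Φ) :
    MorphismProperty.HasSmallObjectArgument.{w} S := by
  obtain ⟨κ, hκ, hbot, hS'⟩ :=
    MorphismProperty.HasSmallObjectArgument.exists_cardinal.{w} (I := S')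
  -- The cardinal that works for `S'` works for `S`: `Φ` sends each `S`-cell complex of length `κ`
  -- to an `S'`-cell complex of the same length and preserves its colimit, and `Hom(A, -)` is
  -- `Hom(A', Φ -)`.
  refine ⟨κ, hκ, hbot, { preservesColimit := ?_ }⟩
  intro A B X Y f hf g c
  obtain ⟨Φ, A', B', f', hf', ⟨e⟩, hΦ, hN, hS⟩ := h f hf
  have h2 := pushouts_coproducts_map hΦ hN hS
  have hN' : (MorphismProperty.coproducts.{w} S).pushouts ≤ N :=
    (MorphismProperty.pushouts_monotone (MorphismProperty.coproducts_monotone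
      (hN.trans inf_le_left))).trans (by simp)
  have hcN (j : κ.ord.ToType) (hj : ¬ IsMax j) : (MorphismProperty.coproducts.{w} S).pushouts
      (c.F.map (homOfLE (Order.le_succ j))) := by
    have := (c.attachCells j hj).pushouts_coproducts
    rwa [MorphismProperty.ofHoms_homFamily] at this
  let cN : N.TransfiniteCompositionOfShape κ.ord.ToType g :=
    { toTransfiniteCompositionOfShape := c.toTransfiniteCompositionOfShape
      map_mem := fun j hj => hN' _ (hcN j hj) }
  let c' : RelativeCellComplex.{w} (fun (_ : κ.ord.ToType) ↦ S'.homFamily) (Φ.map g) :=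
    { toTransfiniteCompositionOfShape := mapTransfiniteCompositionOfShape hΦ cN
      attachCells := fun j hj => Nonempty.some (by
        rw [nonempty_attachCells_iff, MorphismProperty.ofHoms_homFamily]
        exact h2 _ (hcN j hj)) }
  have hc' : PreservesColimit (c.F ⋙ Φ) (coyoneda.obj (Opposite.op A')) :=
    MorphismProperty.IsCardinalForSmallObjectArgument.preservesColimit f' hf' _ c'
  have : Nonempty κ.ord.ToType := ⟨⊥⟩
  have := hΦ κ.ord.ToType c.F (fun _ _ a => cN.mem_map a)
  exact preservesColimit_of_natIso c.F e

end SmallObjectArgument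

/-! ### Orbit cells and the adjunction between `G/K ⊗ -` and `K`-fixed points -/

section Orbits

variable {G : Type v} [Group G] {C : Type u} [Category.{v} C] [HasColimits C]

lemma tensor_map_ι (S : Type v) [MulAction G S] {A B : C} (f : A ⟶ B) (s : S) :
    tensorι S A s ≫ underMap ((tensor (G := G) C S).map f) = f ≫ tensorι S B s :=
  Limits.Sigma.ι_map (fun _ : S => f) s

lemma tensor_hom_ext (S : Type v) [MulAction G S] {A : C} {X : GObj G C}
    {φ ψ : (tensor C S).obj A ⟶ X}
    (h : ∀ s, tensorι S A s ≫ underMap φ = tensorι S A s ≫ underMap ψ) : φ = ψ := by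
  ext j
  exact Sigma.hom_ext _ _ h

lemma smul_one_coset (K : Subgroup G) (g : G) :
    g • ((1 : G) : G ⧸ K) = (g : G ⧸ K) := by
  change ((g * 1 : G) : G ⧸ K) = _
  rw [mul_one]

lemma tensorι_coset (K : Subgroup G) (A : C) (X : GObj G C) (φ : (tensor C (G ⧸ K)).obj A ⟶ X)
    (g : G) : tensorι (G ⧸ K) A (g : G ⧸ K) ≫ underMap φ =
      tensorι (G ⧸ K) A ((1 : G) : G ⧸ K) ≫ underMap φ ≫ act X g := by
  rw [← act_naturality, ← Category.assoc, tensorι_act, smul_one_coset]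

variable [HasLimits C]

/-- The map `G/K ⊗ A ⟶ X` induced by a map `A ⟶ X^K`, on underlying objects. -/
noncomputable def underDesc (K : Subgroup G) (A : C) (X : GObj G C)
    (t : A ⟶ (fixedPoints C K).obj X) : under ((tensor (G := G) C (G ⧸ K)).obj A) ⟶ under X :=
  Limits.Sigma.desc fun s : G ⧸ K => t ≫ fixedι K X ≫ act X (Quotient.out s)

lemma tensorι_underDesc (K : Subgroup G) (A : C) (X : GObj G C)
    (t : A ⟶ (fixedPoints C K).obj X) (g : G) :
    tensorι (G ⧸ K) A (g : G ⧸ K) ≫ underDesc K A X t = t ≫ fixedι K X ≫ act X g :=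
  (Limits.Sigma.ι_desc _ _).trans (by
    rw [fixedι_act_congr K X (g' := g) (Quotient.out_eq' _)])

lemma act_underDesc (K : Subgroup G) (A : C) (X : GObj G C)
    (t : A ⟶ (fixedPoints C K).obj X) (g : G) :
    act ((tensor (G := G) C (G ⧸ K)).obj A) g ≫ underDesc K A X t = underDesc K A X t ≫ act X g := by
  have h (s : G ⧸ K) :
      tensorι (G ⧸ K) A s ≫ act ((tensor (G := G) C (G ⧸ K)).obj A) g ≫ underDesc K A X t =
        tensorι (G ⧸ K) A s ≫ underDesc K A X t ≫ act X g := by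
    induction s using QuotientGroup.induction_on with
    | H k =>
      rw [← Category.assoc, tensorι_act, ← Category.assoc (tensorι _ _ _), tensorι_underDesc]
      refine (tensorι_underDesc K A X t (g * k)).trans ?_
      rw [act_mul]
      simp only [Category.assoc]
  exact Sigma.hom_ext _ _ h

/-- The map `G/K ⊗ A ⟶ X` induced by a map `A ⟶ X^K`. -/
noncomputable def tensorDesc (K : Subgroup G) (A : C) (X : GObj G C)
    (t : A ⟶ (fixedPoints C K).obj X) : (tensor C (G ⧸ K)).obj A ⟶ X where
  app _ := underDesc K A X t
  naturality _ _ g := act_underDesc K A X t g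

lemma tensorι_desc (K : Subgroup G) (A : C) (X : GObj G C)
    (t : A ⟶ (fixedPoints C K).obj X) (g : G) :
    tensorι (G ⧸ K) A (g : G ⧸ K) ≫ underMap (tensorDesc K A X t) =
      t ≫ fixedι K X ≫ act X g := tensorι_underDesc K A X t g

/-- The map `A ⟶ X^K` induced by a map `G/K ⊗ A ⟶ X`. -/
noncomputable def toFixed (K : Subgroup G) (A : C) (X : GObj G C)
    (φ : (tensor C (G ⧸ K)).obj A ⟶ X) : A ⟶ (fixedPoints C K).obj X :=
  fixedLift K X (tensorι _ A ((1 : G) : G ⧸ K) ≫ underMap φ) fun k hk => by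
    rw [Category.assoc, ← tensorι_coset,
      show (k : G ⧸ K) = ((1 : G) : G ⧸ K) from QuotientGroup.eq.2 (by simpa using hk)]

lemma toFixed_ι (K : Subgroup G) (A : C) (X : GObj G C) (φ : (tensor C (G ⧸ K)).obj A ⟶ X) :
    toFixed K A X φ ≫ fixedι K X = tensorι _ A ((1 : G) : G ⧸ K) ≫ underMap φ :=
  fixedLift_ι _ _ _ _

lemma toFixed_comp (K : Subgroup G) (A : C) {X Y : GObj G C} (φ : (tensor C (G ⧸ K)).obj A ⟶ X)
    (f : X ⟶ Y) : toFixed K A Y (φ ≫ f) = toFixed K A X φ ≫ (fixedPoints C K).map f :=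
  fixed_hom_ext _ _ (by
    rw [toFixed_ι, Category.assoc, fixedPoints_map_ι, ← Category.assoc, toFixed_ι, Category.assoc]
    rfl)

lemma tensorDesc_comp (K : Subgroup G) {A B : C} (X : GObj G C) (f : A ⟶ B)
    (t : B ⟶ (fixedPoints C K).obj X) :
    tensorDesc K A X (f ≫ t) = (tensor C (G ⧸ K)).map f ≫ tensorDesc K B X t :=
  tensor_hom_ext _ fun s => by
    induction s using QuotientGroup.induction_on with
    | H g =>
      rw [tensorι_desc]
      change _ = _ ≫ underMap _ ≫ underMap _
      rw [← Category.assoc (tensorι _ _ _), tensor_map_ι, Category.assoc, Category.assoc,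
        tensorι_desc]

variable (C) in
/-- The functor `G/K ⊗ -` is left adjoint to the `K`-fixed points. -/
noncomputable def tensorAdjunction (K : Subgroup G) : tensor C (G ⧸ K) ⊣ fixedPoints C K :=
  Adjunction.mkOfHomEquiv
    { homEquiv := fun A X =>
        { toFun := toFixed K A X
          invFun := tensorDesc K A X
          left_inv := fun φ => tensor_hom_ext _ fun s => by
            induction s using QuotientGroup.induction_on with
            | H g => rw [tensorι_desc, ← Category.assoc, toFixed_ι, tensorι_coset K A X φ g,
                Category.assoc]
          right_inv := fun t => fixed_hom_ext _ _ (by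
            rw [toFixed_ι, tensorι_desc, act_one, Category.comp_id]) }
      homEquiv_naturality_left_symm := fun f t => tensorDesc_comp K _ f t
      homEquiv_naturality_right := fun φ f => toFixed_comp K _ φ f }

variable (C) in
/-- The object `G/K ⊗ A` corepresents the maps from `A` to the `K`-fixed points. -/
noncomputable def fixedPointsCoyonedaIso (K : Subgroup G) (A : C) :
    fixedPoints C K ⋙ coyoneda.obj (Opposite.op A) ≅
      coyoneda.obj (Opposite.op ((tensor C (G ⧸ K)).obj A)) :=
  NatIso.ofComponents (fun X => ((tensorAdjunction C K).homEquiv A X).symm.toIso) (fun f => by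
    ext t
    exact (tensorAdjunction C K).homEquiv_naturality_right_symm t f)

/-- On `(G/K)^H ⊗ A` the comparison map is natural in `A`. -/
lemma fixedComparison_naturality (H : Subgroup G) (S : Type v) [MulAction G S] {A B : C}
    (f : A ⟶ B) :
    (Limits.Sigma.map fun _ : MulAction.fixedPoints H S => f) ≫ fixedComparison H S B =
      fixedComparison H S A ≫ (fixedPoints C H).map ((tensor C S).map f) := by
  refine Sigma.hom_ext _ _ fun s => fixed_hom_ext _ _ ?_
  rw [← Category.assoc, Limits.Sigma.ι_map, Category.assoc, Category.assoc, Category.assoc,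
    Category.assoc, fixedPoints_map_ι, fixedComparison, fixedComparison, ← Category.assoc,
    ← Category.assoc, ← Category.assoc, ← Category.assoc, Category.assoc f, Limits.Sigma.ι_desc,
    Limits.Sigma.ι_desc, Category.assoc, fixedLift_ι, fixedLift_ι, tensor_map_ι]

/-- The class of morphisms `G/K ⊗ f` for `f` in `S`. -/
def orbitCells (G : Type v) [Group G] (S : MorphismProperty C) : MorphismProperty (GObj G C) :=
  MorphismProperty.ofHoms fun p : Subgroup G × S.toSet => (tensor C (G ⧸ p.1)).map p.2.1.hom

omit [HasLimits C] in
lemma orbitCells_map {S : MorphismProperty C} (K : Subgroup G) {A B : C} {f : A ⟶ B} (hf : S f) :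
    orbitCells G S ((tensor C (G ⧸ K)).map f) :=
  ⟨((K, ⟨Arrow.mk f, hf⟩) : Subgroup G × S.toSet)⟩

instance (S : MorphismProperty C) [MorphismProperty.IsSmall.{v} S] :
    MorphismProperty.IsSmall.{v} (orbitCells G S) := by
  unfold orbitCells
  infer_instance

omit [HasLimits C] in
lemma orbitCells_le_iff {S : MorphismProperty C} {P : MorphismProperty (GObj G C)} :
    orbitCells G S ≤ P ↔ ∀ (K : Subgroup G) ⦃A B : C⦄ (f : A ⟶ B), S f →
      P ((tensor C (G ⧸ K)).map f) := by
  refine ⟨fun h K A B f hf => h _ (orbitCells_map K hf), ?_⟩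
  rintro h X Y _ ⟨p⟩
  exact h p.1 _ p.2.2

lemma orbitCells_rlp_iff {S : MorphismProperty C} {X Y : GObj G C} (p : X ⟶ Y) :
    (orbitCells G S).rlp p ↔ ∀ K : Subgroup G, S.rlp ((fixedPoints C K).map p) := by
  refine ⟨fun h K A B f hf => ?_, ?_⟩
  · rw [← (tensorAdjunction C K).hasLiftingProperty_iff]
    exact h _ (orbitCells_map K hf)
  · rintro h A B _ ⟨q⟩
    rw [(tensorAdjunction C q.1).hasLiftingProperty_iff]
    exact h q.1 _ q.2.2

end Orbits

/-! ### Fixed points of the saturated classes of orbit cells -/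

section Model

variable {G : Type v} [Group G] {C : Type u} [Category.{v} C] [ModelCategory C] [HasColimits C]
  [HasLimits C]

variable (G C) in
/-- The class of morphisms of `G`-objects that are non-equivariant cofibrations. -/
def underCofibrations : MorphismProperty (GObj G C) :=
  (cofibrations C).inverseImage ((evaluation _ C).obj (SingleObj.star G))

instance : MorphismProperty.IsStableUnderTransfiniteComposition.{v} (cofibrations C) := by
  rw [← trivialFibrations_llp]
  infer_instance

instance : MorphismProperty.IsStableUnderTransfiniteComposition.{v} (trivialCofibrations C) := by
  rw [← fibrations_llp]
  infer_instance

instance : MorphismProperty.IsStableUnderCoproducts.{v} (cofibrations C) where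

instance : MorphismProperty.IsStableUnderCoproducts.{v} (trivialCofibrations C) where

instance : (underCofibrations G C).IsStableUnderRetracts :=
  inferInstanceAs ((cofibrations C).inverseImage _).IsStableUnderRetracts

instance : (underCofibrations G C).IsStableUnderCobaseChange where
  of_isPushout sq hf := (cofibrations C).of_isPushout (sq.map ((evaluation _ C).obj _)) hf

instance : MorphismProperty.IsStableUnderCoproducts.{v} (underCofibrations G C) where
  isStableUnderCoproductsOfShape _ :=
    { condition := fun _ _ _ _ h₁ h₂ f hf _ hφ =>
        MorphismProperty.IsStableUnderColimitsOfShape.condition (W := cofibrations C) _ _ _ _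
          (isColimitOfPreserves ((evaluation _ C).obj (SingleObj.star G)) h₁)
          (isColimitOfPreserves ((evaluation _ C).obj (SingleObj.star G)) h₂)
          (Functor.whiskerRight f _) hf _ fun j => congrArg underMap (hφ j) }

instance : MorphismProperty.IsStableUnderTransfiniteComposition.{v} (underCofibrations G C) where
  isStableUnderTransfiniteCompositionOfShape J _ _ _ _ :=
    ⟨fun _ _ f hf => (cofibrations C).transfiniteCompositionsOfShape_le J _
      (MorphismProperty.transfiniteCompositionsOfShape_map_of_preserves J
        ((evaluation _ C).obj (SingleObj.star G)) f hf)⟩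

variable {I J : MorphismProperty C} (hC : IsCofibrantlyGeneratedBy I J)
  (hfix : ∀ H : Subgroup G, FixedPointConditions I H)

omit [HasColimits C] [HasLimits C] in
include hC in
lemma le_cofibrations : I ≤ cofibrations C := by
  rw [← trivialFibrations_llp, hC.trivialFibrations_eq]
  exact I.le_llp_rlp

omit [HasColimits C] [HasLimits C] in
include hC in
lemma le_trivialCofibrations : J ≤ trivialCofibrations C := by
  rw [← fibrations_llp, hC.fibrations_eq]
  exact J.le_llp_rlp

include hfix

lemma preservesFilteredColimitsIn (H : Subgroup G) :
    PreservesFilteredColimitsIn.{v} (fixedPoints C H) (underCofibrations G C) :=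
  fun K _ _ F hF => (hfix H).preserves_filtered K F fun _ _ a => ⟨hF a⟩

/-- By condition 3 and naturality of the comparison map, `(G/K ⊗ f)^H` is the coproduct of copies of
`f` indexed by `(G/K)^H`. -/
lemma fixedPoints_tensor_mem_coproducts {S : MorphismProperty C} (H : Subgroup G) :
    orbitCells G S ≤ (MorphismProperty.coproducts.{v} S).inverseImage (fixedPoints C H) := by
  rw [orbitCells_le_iff]
  intro K A B f hf
  have hA : IsIso (fixedComparison H (G ⧸ K) A) := (hfix H).isIso_comparison K A
  have hB : IsIso (fixedComparison H (G ⧸ K) B) := (hfix H).isIso_comparison K B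
  exact ((MorphismProperty.coproducts.{v} S).arrow_mk_iso_iff
    (Arrow.isoMk (@asIso _ _ _ _ (fixedComparison H (G ⧸ K) A) hA)
      (@asIso _ _ _ _ (fixedComparison H (G ⧸ K) B) hB)
      (fixedComparison_naturality H (G ⧸ K) f).symm)).1
    (sigmaMap_mem_coproducts (fun _ => f) fun _ => hf)

omit [HasLimits C] hfix in
lemma orbitCells_le_underCofibrations {S : MorphismProperty C} (hS : S ≤ cofibrations C) :
    orbitCells G S ≤ underCofibrations G C := by
  rw [orbitCells_le_iff]
  intro K A B f hf
  exact MorphismProperty.colimMap (W := cofibrations C) _ fun _ => hS _ hf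

include hC

lemma orbitCells_le_pushoutsAlong (H : Subgroup G) :
    orbitCells G I ≤ underCofibrations G C ⊓ pushoutsAlong (fixedPoints C H) := by
  refine le_inf (orbitCells_le_underCofibrations (le_cofibrations hC)) ?_
  rw [orbitCells_le_iff]
  intro K A B f hf X Y g g' f' sq
  have := (hfix H).preserves_pushouts K f hf g
  exact sq.map (fixedPoints C H)

lemma hasSmallObjectArgument_orbitCells_I :
    MorphismProperty.HasSmallObjectArgument.{v} (orbitCells G I) := by
  have := hC.isSmall_I
  have := hC.smallObjectArgument_I
  refine hasSmallObjectArgument_of_cells (N := underCofibrations G C) (S' := I) ?_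
  rintro _ _ _ ⟨p⟩
  exact ⟨fixedPoints C p.1, _, _, p.2.1.hom, p.2.2, ⟨fixedPointsCoyonedaIso C p.1 _⟩,
    preservesFilteredColimitsIn hfix _, orbitCells_le_pushoutsAlong hC hfix _,
    fixedPoints_tensor_mem_coproducts hfix _⟩

/-- The relative cell complexes for `orbitCells G I` and their retracts are non-equivariant
cofibrations, and the fixed point functors send them to cofibrations and preserve pushouts
along them. -/
lemma llp_rlp_orbitCells_I_le (H : Subgroup G) : (orbitCells G I).rlp.llp ≤
    underCofibrations G C ⊓ pushoutsAlong (fixedPoints C H) ⊓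
      (cofibrations C).inverseImage (fixedPoints C H) := by
  have := hasSmallObjectArgument_orbitCells_I hC hfix
  refine llp_rlp_le_of_le (preservesFilteredColimitsIn hfix H)
    (orbitCells_le_pushoutsAlong hC hfix H) fun X Y f hf => ?_
  exact ((MorphismProperty.coproducts_monotone (le_cofibrations hC)).trans (by simp)) _
    (fixedPoints_tensor_mem_coproducts hfix H f hf)

omit hfix in
-- Levelwise trivial fibrations are levelwise fibrations. Since condition 2 concerns only `I`, this
-- inclusion is how preservation of pushouts reaches the cells from `J`.
lemma orbitCells_J_le : orbitCells G J ≤ (orbitCells G I).rlp.llp := by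
  rw [MorphismProperty.le_llp_iff_le_rlp]
  intro X Y p hp
  rw [orbitCells_rlp_iff] at hp ⊢
  intro K
  have := hp K
  rw [← hC.trivialFibrations_eq] at this
  rw [← hC.fibrations_eq]
  exact this.1

lemma orbitCells_J_le_pushoutsAlong (H : Subgroup G) :
    orbitCells G J ≤ underCofibrations G C ⊓ pushoutsAlong (fixedPoints C H) :=
  (orbitCells_J_le hC).trans ((llp_rlp_orbitCells_I_le hC hfix H).trans inf_le_left)

lemma hasSmallObjectArgument_orbitCells_J :
    MorphismProperty.HasSmallObjectArgument.{v} (orbitCells G J) := by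
  have := hC.isSmall_J
  have := hC.smallObjectArgument_J
  refine hasSmallObjectArgument_of_cells (N := underCofibrations G C) (S' := J) ?_
  rintro _ _ _ ⟨p⟩
  exact ⟨fixedPoints C p.1, _, _, p.2.1.hom, p.2.2, ⟨fixedPointsCoyonedaIso C p.1 _⟩,
    preservesFilteredColimitsIn hfix _, orbitCells_J_le_pushoutsAlong hC hfix _,
    fixedPoints_tensor_mem_coproducts hfix _⟩

lemma llp_rlp_orbitCells_J_le (H : Subgroup G) : (orbitCells G J).rlp.llp ≤
    (trivialCofibrations C).inverseImage (fixedPoints C H) := by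
  have := hasSmallObjectArgument_orbitCells_J hC hfix
  refine (llp_rlp_le_of_le (preservesFilteredColimitsIn hfix H)
    (orbitCells_J_le_pushoutsAlong hC hfix H) (Q := trivialCofibrations C)
    fun X Y f hf => ?_).trans inf_le_right
  exact ((MorphismProperty.coproducts_monotone (le_trivialCofibrations hC)).trans (by simp)) _
    (fixedPoints_tensor_mem_coproducts hfix H f hf)

end Model

/-- Quillen's recognition principle: two classes of morphisms `I` and `J` for which the expected
factorizations exist generate a model structure with weak equivalences `W`. -/
@[reducible]
def modelCategoryOfGenerators {D : Type u₁} [Category.{v₁} D] [HasFiniteLimits D]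
    [HasFiniteColimits D] (W I J : MorphismProperty D) [W.HasTwoOutOfThreeProperty]
    [MorphismProperty.HasFactorization I.rlp.llp I.rlp]
    [MorphismProperty.HasFactorization J.rlp.llp J.rlp]
    (hI : I.rlp = J.rlp ⊓ W) (hJ : J.rlp.llp ≤ W) : ModelCategory D :=
  letI : CategoryWithFibrations D := ⟨J.rlp⟩
  letI : CategoryWithCofibrations D := ⟨I.rlp.llp⟩
  letI : CategoryWithWeakEquivalences D := ⟨W⟩
  have : (weakEquivalences D).HasTwoOutOfThreeProperty := ‹W.HasTwoOutOfThreeProperty›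
  have htf : trivialFibrations D = I.rlp := hI.symm
  have htc : trivialCofibrations D = J.rlp.llp := by
    apply le_antisymm
    · intro A B f hf
      -- Retract argument: by two-out-of-three the second factor `hd.p` lies in `W`, so `f` lifts
      -- against it and is a retract of `hd.i`.
      have hd := MorphismProperty.factorizationData J.rlp.llp J.rlp f
      have hp : I.rlp hd.p := by
        rw [hI]
        exact ⟨hd.hp, W.of_precomp hd.i hd.p (hJ _ hd.hi) (by rw [hd.fac]; exact hf.2)⟩
      have := hf.1 _ hp
      exact MorphismProperty.of_retract (RetractArrow.ofLeftLiftingProperty hd.fac) hd.hi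
    · refine le_inf (MorphismProperty.antitone_llp ?_) hJ
      rw [hI]
      exact inf_le_left
  have : MorphismProperty.IsWeakFactorizationSystem (cofibrations D) (trivialFibrations D) := by
    rw [htf]
    exact { rlp := MorphismProperty.rlp_llp_rlp I, llp := rfl, hasFactorization := ‹_› }
  have : MorphismProperty.IsWeakFactorizationSystem (trivialCofibrations D) (fibrations D) := by
    rw [htc]
    exact { rlp := MorphismProperty.rlp_llp_rlp J, llp := rfl, hasFactorization := ‹_› }
  .mk' D

/-! ### Existence and left properness of the fixed point model structure -/

section

variable {G : Type v} [Group G] {C : Type u} [Category.{v} C] [ModelCategory C] [HasColimits C]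
  [HasLimits C]

omit [ModelCategory C] [HasColimits C] in
lemma functorCategory_inverseImage_Phi_iff (W : MorphismProperty C) {X Y : GObj G C} (f : X ⟶ Y) :
    (W.functorCategory (OrbitCategory G)ᵒᵖ).inverseImage (Phi G C) f ↔
      ∀ H : Subgroup G, W ((fixedPoints C H).map f) :=
  ⟨fun h H => h (Opposite.op ⟨H⟩), fun h P => h P.unop.stab⟩

instance (W : MorphismProperty C) [W.HasTwoOutOfThreeProperty] (K : Type*) [Category* K] :
    (W.functorCategory K).HasTwoOutOfThreeProperty where
  comp_mem _ _ hf hg j := W.comp_mem _ _ (hf j) (hg j)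
  of_postcomp _ _ hg hfg j := W.of_postcomp _ _ (hg j) (hfg j)
  of_precomp _ _ hf hfg j := W.of_precomp _ _ (hf j) (hfg j)

variable {I J : MorphismProperty C} (hC : IsCofibrantlyGeneratedBy I J)
  (hfix : ∀ H : Subgroup G, FixedPointConditions I H)

include hC

lemma orbitCells_J_rlp : (orbitCells G J).rlp =
    ((fibrations C).functorCategory (OrbitCategory G)ᵒᵖ).inverseImage (Phi G C) := by
  ext X Y f
  rw [orbitCells_rlp_iff, functorCategory_inverseImage_Phi_iff, hC.fibrations_eq]

lemma orbitCells_I_rlp : (orbitCells G I).rlp =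
    ((fibrations C).functorCategory (OrbitCategory G)ᵒᵖ).inverseImage (Phi G C) ⊓
    ((weakEquivalences C).functorCategory (OrbitCategory G)ᵒᵖ).inverseImage (Phi G C) := by
  ext X Y f
  rw [orbitCells_rlp_iff, ← hC.trivialFibrations_eq]
  refine Iff.trans ?_ (and_congr (functorCategory_inverseImage_Phi_iff _ f)
    (functorCategory_inverseImage_Phi_iff _ f)).symm
  exact forall_and

include hfix

theorem exists_isFixedPointModelStructure :
    ∃ M : ModelCategory (GObj G C), IsFixedPointModelStructure M := by
  have := hasSmallObjectArgument_orbitCells_I hC hfix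
  have := hasSmallObjectArgument_orbitCells_J hC hfix
  refine ⟨modelCategoryOfGenerators
    (((weakEquivalences C).functorCategory (OrbitCategory G)ᵒᵖ).inverseImage (Phi G C))
    (orbitCells G I) (orbitCells G J) ?_ ?_, ⟨rfl, orbitCells_J_rlp hC⟩⟩
  · rw [orbitCells_I_rlp hC, orbitCells_J_rlp hC]
  · intro X Y f hf
    rw [functorCategory_inverseImage_Phi_iff]
    exact fun H => (llp_rlp_orbitCells_J_le hC hfix H f hf).2

theorem IsFixedPointModelStructure.isLeftProper (hproper : IsLeftProper C)
    (M : ModelCategory (GObj G C)) (hM : IsFixedPointModelStructure M) :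
    IsLeftProper (GObj G C) := by
  intro X Y Z W h f f' h' sq hh hf
  -- Although `M` is arbitrary, its trivial fibrations are prescribed, so its cofibrations are the
  -- saturation of the orbit cells from `I`.
  have htf : trivialFibrations (GObj G C) = (orbitCells G I).rlp := by
    rw [orbitCells_I_rlp hC, ← hM.fibrations_eq, ← hM.weakEquivalences_eq]
    rfl
  have hcell : (orbitCells G I).rlp.llp h := by
    rw [← htf, trivialFibrations_llp]
    exact hh.mem
  rw [weakEquivalence_iff, hM.weakEquivalences_eq, functorCategory_inverseImage_Phi_iff] at hf ⊢
  intro H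
  obtain ⟨⟨_, hpush⟩, hcof⟩ := llp_rlp_orbitCells_I_le hC hfix H h hcell
  exact (hproper (hpush sq) ⟨hcof⟩ ⟨hf H⟩).mem

end

end GModel

theorem mainTheorem4 {G : Type v} [Group G] {C : Type u} [Category.{v} C] [ModelCategory C]
    [HasLimits C] [HasColimits C] {I J : MorphismProperty C}
    (hC : GModel.IsCofibrantlyGeneratedBy I J)
    (hproper : GModel.IsLeftProper C)
    (hfix : ∀ H : Subgroup G, GModel.FixedPointConditions I H) :
    (∃ M : ModelCategory (GModel.GObj G C), GModel.IsFixedPointModelStructure M) ∧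
      ∀ M : ModelCategory (GModel.GObj G C), GModel.IsFixedPointModelStructure M →
        GModel.IsLeftProper (GModel.GObj G C) :=
  ⟨GModel.exists_isFixedPointModelStructure hC hfix,
    fun M hM => GModel.IsFixedPointModelStructure.isLeftProper hC hfix hproper M hM⟩
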